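/- Let $\mathbb D=\{z\in\mathbb C:|z|<1\}$ and let $\mathcal A$ be the class of functions $F$ analytic in $\mathbb D$ with $F(0)=0$ and $F'(0)=1$. For $0\le\xi\le 1$ let $M(\xi)$ (the Pascu class of $\xi$-convex functions) be the class of all $F\in\mathcal A$ such that $$\operatorname{Re}\frac{\xi z(zF'(z))'+(1-\xi)zF'(z)}{\xi zF'(z)+(1-\xi)F(z)}>0\qquad(0<|z|<1),$$ where the denominator is required not to vanish for $0<|z|<1$ (at $z=0$ the quotient has the limit $1$). Theorem. Let $0\le\xi\le1$ and $\nu\ge\mu\ge1$, and let $\alpha,\gamma$ be the real numbers determined by $\mu+\nu=\alpha-\gamma$ and $\mu\nu=\gamma$. For $0\le t<1$ put $$g(t)=2\sum_{n=0}^\infty\frac{(n+1)(-1)^nt^n}{(1+\mu n)(1+\nu n)}-1,\qquad q(t)=\sum_{n=0}^\infty\frac{(n+1)^2(-1)^nt^n}{(1+\mu n)(1+\nu n)},$$ and let $\beta<1$ be given by $$\frac{\beta}{1-\beta}=-\int_0^1\bigl[(1-\xi)g(t)+\xi(2q(t)-1)\bigr]\,dt .$$ If $F\in\mathcal A$ satisfies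 $$\operatorname{Re}\bigl(F'(z)+\alpha zF''(z)+\gamma z^2F'''(z)\bigr)>\beta\qquad(z\in\mathbb D),$$ then $F\in M(\xi)$. -/

import Mathlib

namespace Pascu

/-- The class `𝒜` of functions analytic in the open unit disc, normalized by `f(0) = 0` and
`f'(0) = 1`. -/
def ClassA (f : ℂ → ℂ) : Prop :=
  DifferentiableOn ℂ f (Metric.ball 0 1) ∧ f 0 = 0 ∧ deriv f 0 = 1

/-- The Pascu class `M(ξ)` of `ξ`-convex functions.  At `z = 0` the quotient is a removable
`0 / 0` whose limit is `1`, so the condition is imposed at the other points of the disc.  Since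
`x / 0 = 0` and the inequality is strict, it forces the denominator to be nonzero there. -/
def ClassM (ξ : ℝ) (f : ℂ → ℂ) : Prop :=
  ClassA f ∧ ∀ z : ℂ, ‖z‖ < 1 → z ≠ 0 →
    0 < (((ξ : ℂ) * z * deriv (fun w : ℂ => w * deriv f w) z + (1 - (ξ : ℂ)) * z * deriv f z) /
      ((ξ : ℂ) * z * deriv f z + (1 - (ξ : ℂ)) * f z)).re

/-- `g(t) = 2 ∑ (n+1)(-1)ⁿ tⁿ / ((1+μn)(1+νn)) - 1`, convergent for `0 ≤ t < 1`. -/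
noncomputable def g (μ ν t : ℝ) : ℝ :=
  2 * (∑' n : ℕ, ((n : ℝ) + 1) * (-1) ^ n * t ^ n / ((1 + μ * n) * (1 + ν * n))) - 1

/-- `q(t) = ∑ (n+1)² (-1)ⁿ tⁿ / ((1+μn)(1+νn))`, convergent for `0 ≤ t < 1`. -/
noncomputable def q (μ ν t : ℝ) : ℝ :=
  ∑' n : ℕ, ((n : ℝ) + 1) ^ 2 * (-1) ^ n * t ^ n / ((1 + μ * n) * (1 + ν * n))

/-- The equation that determines `β` for the weight `lam`:
`β / (1 - β) = - ∫₀¹ lam(t) [(1 - ξ) g(t) + ξ (2 q(t) - 1)] dt`. -/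
def BetaCondition (lam : ℝ → ℝ) (ξ μ ν β : ℝ) : Prop :=
  β / (1 - β) = -∫ t in (0 : ℝ)..1, lam t * ((1 - ξ) * g μ ν t + ξ * (2 * q μ ν t - 1))

end Pascu

/-! ### Elementary inequalities for the real kernels -/

namespace Pascu

open intervalIntegral

/-! Write `F' = ∑ bₙ zⁿ`, so that the operator in the hypothesis gives `H = ∑ hₙ zⁿ` with `hₙ =
(1+μn)(1+νn) bₙ`. Divided by `z`, the numerator and denominator of the Pascu quotient are `X = ∑ cₙ
hₙ zⁿ/(n+1)` and `Y = ∑ cₙ hₙ zⁿ/(n+1)²`, where `cₙ` is `kernelCoeff`. Since `ξ ≤ 1 ≤ μ ≤ ν`, the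
`cₙ` are the moments of a probability measure `τ` on `[0,1]`; since `Re H > β`, Herglotz on a circle
of radius `ρ > |z|` makes `hₙ ρⁿ`, for `n ≥ 1`, twice the moments of a measure `m` of mass `1-β` on
the unit circle.

Let `U`, `V`, `v` stand for `recipTransform`, `sqRecipTransform`, `recipValue`. The equation for `β`
says exactly that the constant terms are absorbed by `v`: `X = 2∫(U(zωs/ρ) - v(s))` and `Y =
2∫(V(zωs/ρ) - v(s))` over `m × τ` (`integrable_and_hasSum_prod`).

Now `Re(X/Y) > 0` follows from `|X-Y| < Re(X+Y)`, which is obtained by integrating the pointwise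
bound `|U-V| ≤ Re(U+V) - 2v(|w|)` (`norm_recipTransform_sub_le`); strictness comes from the strict
decrease of `v`. The pointwise bound amounts to `Im(U-V)² ≤ 4 (Re U - v)(Re V - v)`, proved by
Cauchy–Schwarz (`sq_integral_log_kernel_le`) and an explicit antiderivative
(`integral_kernel_cube_le`). -/

theorem mul_sq_log_le {t : ℝ} (ht : 0 < t) (ht1 : t ≤ 1) :
    t * Real.log t ^ 2 ≤ (1 - t) ^ 2 := by
  -- With `t = e^{-2y}` the claim is the square of `y ≤ sinh y` multiplied by `2e^{-y}`.
  obtain ⟨y, hy⟩ : ∃ y, y = -Real.log t / 2 := ⟨_, rfl⟩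
  have hlog : Real.log t = -2 * y := by rw [hy]; ring
  have hy0 : 0 ≤ y := by
    have := Real.log_nonpos ht.le ht1
    linarith
  have het : t = Real.exp (-y) ^ 2 := by
    rw [← Real.exp_nat_mul, ← Real.exp_log ht, hlog]
    congr 1
    push_cast
    ring
  have hs := Real.self_le_sinh_iff.2 hy0
  rw [Real.sinh_eq] at hs
  have he : Real.exp y * Real.exp (-y) = 1 := by rw [← Real.exp_add]; simp
  have hpos := Real.exp_pos (-y)
  have h1 : 2 * y * Real.exp (-y) ≤ 1 - Real.exp (-y) ^ 2 := by nlinarith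
  have h0 : 0 ≤ 2 * y * Real.exp (-y) := by positivity
  rw [hlog, het]
  calc Real.exp (-y) ^ 2 * (-2 * y) ^ 2 = (2 * y * Real.exp (-y)) ^ 2 := by ring
    _ ≤ _ := pow_le_pow_left₀ h0 h1 2

theorem mul_mem_unit {r t : ℝ} (hr : 0 < r) (hr1 : r < 1) (ht : t ∈ Set.Icc (0 : ℝ) 1) :
    0 ≤ t * r ∧ t * r < 1 :=
  ⟨mul_nonneg ht.1 hr.le, by nlinarith [ht.1, ht.2]⟩

theorem kernel_pos {p c : ℝ} (hc : c ≤ 1) (hp0 : 0 ≤ p) (hp1 : p < 1) :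
    0 < 1 - 2 * p * c + p ^ 2 := by
  nlinarith [mul_nonneg hp0 (sub_nonneg.2 hc), sq_pos_of_pos (sub_pos.2 hp1)]

/-- The right integrand minus the left one is the derivative of an explicit function vanishing at `t
= 0` and `t = 1`, plus a nonnegative remainder. Here `c` plays the cosine of the argument of `z`. -/
theorem integral_kernel_cube_le {r c : ℝ} (hr : 0 < r) (hr1 : r < 1) (hc : -1 ≤ c)
    (hc1 : c ≤ 1) :
    (1 - c) * ∫ t in (0 : ℝ)..1, r * (1 - t) ^ 2 * (1 - t * r) * (1 + t * r) ^ 3 /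
        (1 - 2 * (t * r) * c + (t * r) ^ 2) ^ 3 ≤
      4 * ∫ t in (0 : ℝ)..1, (1 - t) * (t * r) / (1 + t * r) ^ 2 *
        (1 + (1 + c) * (1 - (t * r) ^ 2) / (1 - 2 * (t * r) * c + (t * r) ^ 2)) := by
  have hN : ∀ t ∈ Set.Icc (0 : ℝ) 1, 1 - 2 * (t * r) * c + (t * r) ^ 2 ≠ 0 := fun t ht =>
    (kernel_pos hc1 (mul_mem_unit hr hr1 ht).1 (mul_mem_unit hr hr1 ht).2).ne'
  have hP : ∀ t ∈ Set.Icc (0 : ℝ) 1, 1 + t * r ≠ 0 := fun t ht => by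
    have := (mul_mem_unit hr hr1 ht).1
    positivity
  have hcf : ContinuousOn (fun t : ℝ => r * (1 - t) ^ 2 * (1 - t * r) * (1 + t * r) ^ 3 /
        (1 - 2 * (t * r) * c + (t * r) ^ 2) ^ 3) (Set.Icc 0 1) :=
    ContinuousOn.div (by fun_prop) (by fun_prop) fun t ht => pow_ne_zero 3 (hN t ht)
  have hcg : ContinuousOn (fun t : ℝ => (1 - t) * (t * r) / (1 + t * r) ^ 2 *
        (1 + (1 + c) * (1 - (t * r) ^ 2) / (1 - 2 * (t * r) * c + (t * r) ^ 2)))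
        (Set.Icc 0 1) :=
    (ContinuousOn.div (by fun_prop) (by fun_prop) fun t ht => pow_ne_zero 2 (hP t ht)).mul
      (continuousOn_const.add (ContinuousOn.div (by fun_prop) (by fun_prop) hN))
  have hif := hcf.intervalIntegrable_of_Icc (μ := MeasureTheory.volume) zero_le_one
  have hig := hcg.intervalIntegrable_of_Icc (μ := MeasureTheory.volume) zero_le_one
  rw [← sub_nonneg, ← integral_const_mul, ← integral_const_mul,
    ← integral_sub (hig.const_mul _) (hif.const_mul _)]
  have hder : ∀ t ∈ Set.Icc (0 : ℝ) 1, HasDerivAt (fun t : ℝ =>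
      -((1 - t) ^ 2 * ((1 - c) * (t * r) / (1 - 2 * (t * r) * c + (t * r) ^ 2)) *
        (1 + (1 + c) * (t * r) / (1 - 2 * (t * r) * c + (t * r) ^ 2))) +
      (1 + c) * (1 - t) * (1 - t * r) * t * (t * r) /
        ((1 + t * r) * (1 - 2 * (t * r) * c + (t * r) ^ 2)))
      (4 * ((1 - t) * (t * r) / (1 + t * r) ^ 2 *
        (1 + (1 + c) * (1 - (t * r) ^ 2) / (1 - 2 * (t * r) * c + (t * r) ^ 2))) -
        (1 - c) * (r * (1 - t) ^ 2 * (1 - t * r) * (1 + t * r) ^ 3 /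
        (1 - 2 * (t * r) * c + (t * r) ^ 2) ^ 3) -
        -- The bracket subtracted here is the nonnegative remainder.
        ((1 + c) * (1 - t) * (1 - t * r) * (t * r) * (4 + t * r) /
          ((1 + t * r) ^ 2 * (1 - 2 * (t * r) * c + (t * r) ^ 2)) +
        (1 + c) * (1 - r) * t * (t * r) /
          ((1 + t * r) * (1 - 2 * (t * r) * c + (t * r) ^ 2)))) t := by
    intro t ht
    have hNt := hN t ht
    have hPt := hP t ht
    have dp : HasDerivAt (fun t : ℝ => t * r) r t := by simpa using (hasDerivAt_id t).mul_const r
    have d1 : HasDerivAt (fun t : ℝ => 1 - t) (-1) t := by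
      simpa using (hasDerivAt_id t).const_sub 1
    have dN : HasDerivAt (fun t : ℝ => 1 - 2 * (t * r) * c + (t * r) ^ 2)
        (-(2 * r * c) + 2 * (t * r) * r) t := by
      exact ((((dp.const_mul 2).mul_const c).const_sub 1).add (dp.pow 2)).congr_deriv (by simp)
    have dP : HasDerivAt (fun t : ℝ => 1 + t * r) r t := dp.const_add 1
    have dM : HasDerivAt (fun t : ℝ => 1 - t * r) (-r) t := dp.const_sub 1
    have e1 := ((d1.pow 2).mul ((dp.const_mul (1 - c)).div dN hNt)).mul
      (((dp.const_mul (1 + c)).div dN hNt).const_add 1)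
    have e2 := (((((d1.const_mul (1 + c)).mul dM).mul (hasDerivAt_id t)).mul dp).div
      (dP.mul dN) (mul_ne_zero hPt hNt))
    refine (e1.neg.add e2).congr_deriv ?_
    simp only [Pi.mul_apply, Pi.pow_apply, Pi.div_apply, id]
    generalize hn : 1 - 2 * (t * r) * c + (t * r) ^ 2 = n at hNt ⊢
    field_simp
    subst hn
    ring
  have key := sub_le_integral_of_hasDeriv_right_of_le (a := (0 : ℝ)) (b := 1) zero_le_one
    (fun t ht => (hder t ht).continuousAt.continuousWithinAt)
    (fun t ht => (hder t (Set.Ioo_subset_Icc_self ht)).hasDerivWithinAt)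
    (φ := fun t : ℝ => 4 * ((1 - t) * (t * r) / (1 + t * r) ^ 2 *
        (1 + (1 + c) * (1 - (t * r) ^ 2) / (1 - 2 * (t * r) * c + (t * r) ^ 2))) -
        (1 - c) * (r * (1 - t) ^ 2 * (1 - t * r) * (1 + t * r) ^ 3 /
        (1 - 2 * (t * r) * c + (t * r) ^ 2) ^ 3))
    (((hcg.const_smul (4 : ℝ)).sub (hcf.const_smul (1 - c))).integrableOn_Icc)
    (fun t ht => by
      have ht' := Set.Ioo_subset_Icc_self ht
      obtain ⟨hp0, hp1⟩ := mul_mem_unit hr hr1 ht'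
      have hNp := kernel_pos hc1 hp0 hp1
      have h1 : 0 ≤ 1 + c := by linarith
      have h2 : 0 ≤ 1 - t := by linarith [ht'.2]
      have h3 : 0 ≤ 1 - t * r := by linarith
      have h4 : 0 ≤ 1 - r := by linarith
      have h5 := ht'.1
      rw [sub_le_self_iff]
      positivity)
  simpa using key

end Pascu

/-! ### Cauchy–Schwarz for the logarithmic kernel, and the integral transforms -/

namespace Pascu

open intervalIntegral

/-- Cauchy–Schwarz in discriminant form: the square of the left integrand is at most the product of
the two right ones, by `mul_sq_log_le`. -/
theorem sq_integral_log_kernel_le {r c : ℝ} (hr : 0 < r) (hr1 : r < 1) (hc1 : c ≤ 1) :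
    (∫ t in (0 : ℝ)..1, Real.negMulLog t * r * (1 - (t * r) ^ 2) /
        (1 - 2 * (t * r) * c + (t * r) ^ 2) ^ 2) ^ 2 ≤
      (∫ t in (0 : ℝ)..1, t * r * (1 - t * r) /
        ((1 + t * r) * (1 - 2 * (t * r) * c + (t * r) ^ 2))) *
      ∫ t in (0 : ℝ)..1, r * (1 - t) ^ 2 * (1 - t * r) * (1 + t * r) ^ 3 /
        (1 - 2 * (t * r) * c + (t * r) ^ 2) ^ 3 := by
  have hN : ∀ t ∈ Set.Icc (0 : ℝ) 1, 1 - 2 * (t * r) * c + (t * r) ^ 2 ≠ 0 := fun t ht =>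
    (kernel_pos hc1 (mul_mem_unit hr hr1 ht).1 (mul_mem_unit hr hr1 ht).2).ne'
  have hP : ∀ t ∈ Set.Icc (0 : ℝ) 1, 1 + t * r ≠ 0 := fun t ht => by
    have := (mul_mem_unit hr hr1 ht).1
    positivity
  have hiC : IntervalIntegrable (fun t : ℝ => Real.negMulLog t * r * (1 - (t * r) ^ 2) /
      (1 - 2 * (t * r) * c + (t * r) ^ 2) ^ 2) MeasureTheory.volume 0 1 :=
    ContinuousOn.intervalIntegrable_of_Icc zero_le_one
      (ContinuousOn.div (by fun_prop) (by fun_prop) fun t ht => pow_ne_zero 2 (hN t ht))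
  have hiA : IntervalIntegrable (fun t : ℝ => t * r * (1 - t * r) /
      ((1 + t * r) * (1 - 2 * (t * r) * c + (t * r) ^ 2))) MeasureTheory.volume 0 1 :=
    ContinuousOn.intervalIntegrable_of_Icc zero_le_one
      (ContinuousOn.div (by fun_prop) (by fun_prop) fun t ht => mul_ne_zero (hP t ht) (hN t ht))
  have hiK : IntervalIntegrable (fun t : ℝ => r * (1 - t) ^ 2 * (1 - t * r) * (1 + t * r) ^ 3 /
      (1 - 2 * (t * r) * c + (t * r) ^ 2) ^ 3) MeasureTheory.volume 0 1 :=
    ContinuousOn.intervalIntegrable_of_Icc zero_le_one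
      (ContinuousOn.div (by fun_prop) (by fun_prop) fun t ht => pow_ne_zero 3 (hN t ht))
  have hquad : ∀ x : ℝ, 0 ≤ (∫ t in (0 : ℝ)..1, t * r * (1 - t * r) /
        ((1 + t * r) * (1 - 2 * (t * r) * c + (t * r) ^ 2))) * (x * x) +
      (-2 * ∫ t in (0 : ℝ)..1, Real.negMulLog t * r * (1 - (t * r) ^ 2) /
        (1 - 2 * (t * r) * c + (t * r) ^ 2) ^ 2) * x +
      ∫ t in (0 : ℝ)..1, r * (1 - t) ^ 2 * (1 - t * r) * (1 + t * r) ^ 3 /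
        (1 - 2 * (t * r) * c + (t * r) ^ 2) ^ 3 := by
    intro x
    rw [← integral_mul_const, ← integral_const_mul, ← integral_mul_const,
      ← integral_add (hiA.mul_const _) ((hiC.const_mul _).mul_const _),
      ← integral_add ((hiA.mul_const _).add ((hiC.const_mul _).mul_const _)) hiK]
    refine integral_nonneg zero_le_one fun t ht => ?_
    obtain ⟨hp0, hp1⟩ := mul_mem_unit hr hr1 ht
    have hNp := kernel_pos hc1 hp0 hp1
    have hPt := hP t ht
    have h3 : 0 ≤ 1 - t * r := by linarith
    rcases ht.1.eq_or_lt with h0 | h0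
    · subst h0
      simp [hr.le]
    have hlog := mul_sq_log_le h0 ht.2
    -- Completing the square in `x`; what is left over carries the factor `(1 - t)² - t log² t ≥ 0`.
    calc (0 : ℝ) ≤ t * r * (1 - t * r) / ((1 + t * r) * (1 - 2 * (t * r) * c + (t * r) ^ 2)) *
          (x + Real.log t * (1 + t * r) ^ 2 / (1 - 2 * (t * r) * c + (t * r) ^ 2)) ^ 2 +
          ((1 - t) ^ 2 - t * Real.log t ^ 2) * (r * (1 - t * r) * (1 + t * r) ^ 3 /
        (1 - 2 * (t * r) * c + (t * r) ^ 2) ^ 3) := by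
          refine add_nonneg (by positivity) (mul_nonneg (by linarith) (by positivity))
      _ = _ := by
        rw [Real.negMulLog]
        generalize 1 - 2 * (t * r) * c + (t * r) ^ 2 = n at hNp ⊢
        field_simp
        ring
  have := discrim_le_zero hquad
  rw [discrim] at this
  linarith

theorem intervalIntegrable_log_mul {E : Type*} [NormedRing E] [NormedSpace ℝ E] {f : ℝ → E}
    (hf : ContinuousOn f (Set.Icc 0 1)) :
    IntervalIntegrable (fun t => Real.log t • f t) MeasureTheory.volume 0 1 :=
  intervalIntegral.intervalIntegrable_log'.smul_continuousOn
    (by rwa [Set.uIcc_of_le zero_le_one])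

/-- `∑ zⁿ / (n + 1)` as an integral. -/
noncomputable def recipTransform (z : ℂ) : ℂ := ∫ t in (0 : ℝ)..1, 1 / (1 - t * z)

/-- `∑ zⁿ / (n + 1)²` as an integral. -/
noncomputable def sqRecipTransform (z : ℂ) : ℂ :=
  ∫ t in (0 : ℝ)..1, Real.log t • (-1 / (1 - t * z))

/-- The value of `∑ zⁿ / (n + 1)` at `z = -s`. -/
noncomputable def recipValue (s : ℝ) : ℝ := ∫ t in (0 : ℝ)..1, 1 / (1 + t * s)

theorem one_sub_mul_ne_zero {z : ℂ} (hz : ‖z‖ < 1) {t : ℝ} (ht : t ∈ Set.Icc (0 : ℝ) 1) :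
    1 - t * z ≠ 0 := by
  intro h
  have h1 : ‖(t : ℂ) * z‖ = 1 := by rw [← sub_eq_zero.1 h, norm_one]
  rw [norm_mul, Complex.norm_real, Real.norm_of_nonneg ht.1] at h1
  nlinarith [norm_nonneg z, ht.2]

theorem continuousOn_const_div_one_sub_pow {z : ℂ} (hz : ‖z‖ < 1) (a : ℂ) (n : ℕ) :
    ContinuousOn (fun t : ℝ => a / (1 - t * z) ^ n) (Set.Icc 0 1) :=
  ContinuousOn.div (by fun_prop) (by fun_prop) fun _ ht => pow_ne_zero n (one_sub_mul_ne_zero hz ht)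

/-- Integration by parts against `-t log t`. -/
theorem recipTransform_eq {z : ℂ} (hz : ‖z‖ < 1) :
    recipTransform z = ∫ t in (0 : ℝ)..1, Real.log t • (-1 / (1 - t * z) ^ 2) := by
  have h1 := (continuousOn_const_div_one_sub_pow hz 1 1).intervalIntegrable_of_Icc
    (μ := MeasureTheory.volume) zero_le_one
  have h2 := intervalIntegrable_log_mul (continuousOn_const_div_one_sub_pow hz (-1) 2)
  simp only [pow_one] at h1
  rw [recipTransform, ← sub_eq_zero, ← integral_sub h1 h2]
  have := integral_eq_sub_of_hasDerivAt_of_le (a := (0 : ℝ)) (b := 1) zero_le_one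
    (f := fun t : ℝ => ((t * Real.log t : ℝ) : ℂ) / (1 - t * z))
    (f' := fun t : ℝ => 1 / (1 - t * z) - Real.log t • (-1 / (1 - t * z) ^ 2))
    (ContinuousOn.div (Complex.continuous_ofReal.comp Real.continuous_mul_log).continuousOn
      (by fun_prop) fun t ht => one_sub_mul_ne_zero hz ht)
    (fun t ht => by
      have hne := one_sub_mul_ne_zero hz (Set.Ioo_subset_Icc_self ht)
      have d1 : HasDerivAt (fun t : ℝ => ((t * Real.log t : ℝ) : ℂ)) ((Real.log t + 1 : ℝ) : ℂ) t :=
        (Real.hasDerivAt_mul_log ht.1.ne').ofReal_comp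
      have d2 : HasDerivAt (fun t : ℝ => 1 - (t : ℂ) * z) (-z) t := by
        simpa using ((Complex.ofRealCLM.hasDerivAt (x := t)).mul_const z).const_sub 1
      refine (d1.div d2 hne).congr_deriv ?_
      rw [Complex.real_smul]
      push_cast
      field_simp
      ring)
    (h1.sub h2)
  rw [this]
  simp

theorem re_integral_unit {f : ℝ → ℂ} (hf : IntervalIntegrable f MeasureTheory.volume 0 1) :
    (∫ t in (0 : ℝ)..1, f t).re = ∫ t in (0 : ℝ)..1, (f t).re :=
  (Complex.reCLM.intervalIntegral_comp_comm hf).symm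

theorem im_integral_unit {f : ℝ → ℂ} (hf : IntervalIntegrable f MeasureTheory.volume 0 1) :
    (∫ t in (0 : ℝ)..1, f t).im = ∫ t in (0 : ℝ)..1, (f t).im :=
  (Complex.imCLM.intervalIntegral_comp_comm hf).symm

theorem recipTransform_neg_ofReal (s : ℝ) : recipTransform (-s) = recipValue s := by
  rw [recipTransform, recipValue, ← intervalIntegral.integral_ofReal]
  congr 1
  ext t
  push_cast
  ring

theorem recipValue_eq {r : ℝ} (hr : 0 ≤ r) (hr1 : r < 1) :
    recipValue r = ∫ t in (0 : ℝ)..1, Real.log t • (-1 / (1 + t * r) ^ 2) := by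
  have h : ‖(-r : ℂ)‖ < 1 := by simpa [abs_of_nonneg hr] using hr1
  have := recipTransform_eq h
  rw [recipTransform_neg_ofReal] at this
  rw [← Complex.ofReal_inj, this, ← intervalIntegral.integral_ofReal]
  congr 1
  ext t
  push_cast [Complex.real_smul, smul_eq_mul]
  ring

end Pascu

/-! ### The pointwise inequality between the two transforms -/

namespace Pascu

open intervalIntegral

theorem normSq_one_sub_mul {z : ℂ} (hz : 0 < ‖z‖) (t : ℝ) :
    Complex.normSq (1 - t * z) =
      1 - 2 * (t * ‖z‖) * (z.re / ‖z‖) + (t * ‖z‖) ^ 2 := by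
  have h : ‖z‖ ^ 2 = z.re ^ 2 + z.im ^ 2 := by
    rw [← Complex.normSq_eq_norm_sq, Complex.normSq_apply]; ring
  rw [mul_pow, h, Complex.normSq_apply]
  simp
  field_simp
  ring

theorem abs_re_div_norm_le (z : ℂ) : -1 ≤ z.re / ‖z‖ ∧ z.re / ‖z‖ ≤ 1 := by
  rw [← abs_le, abs_div, abs_norm]
  exact div_le_one_of_le₀ (Complex.abs_re_le_norm z) (norm_nonneg z)

/-- The factor `1 + cos` is isolated to match `sin² = (1 + cos)(1 - cos)` from the imaginary part.
-/
theorem re_recipTransform_sub {z : ℂ} (hz : 0 < ‖z‖) (hz1 : ‖z‖ < 1) :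
    (recipTransform z).re - recipValue ‖z‖ =
      (1 + z.re / ‖z‖) * ∫ t in (0 : ℝ)..1, t * ‖z‖ * (1 - t * ‖z‖) /
        ((1 + t * ‖z‖) * (1 - 2 * (t * ‖z‖) * (z.re / ‖z‖) + (t * ‖z‖) ^ 2)) := by
  have h1 := (continuousOn_const_div_one_sub_pow hz1 1 1).intervalIntegrable_of_Icc
    (μ := MeasureTheory.volume) zero_le_one
  simp only [pow_one] at h1
  have hP : ∀ t ∈ Set.Icc (0 : ℝ) 1, 1 + t * ‖z‖ ≠ 0 := fun t ht => by
    have := (mul_mem_unit hz hz1 ht).1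
    positivity
  have h2 : IntervalIntegrable (fun t : ℝ => 1 / (1 + t * ‖z‖)) MeasureTheory.volume 0 1 :=
    ContinuousOn.intervalIntegrable_of_Icc zero_le_one
      (ContinuousOn.div (by fun_prop) (by fun_prop) hP)
  have h1' : IntervalIntegrable (fun t : ℝ => (1 / (1 - t * z)).re) MeasureTheory.volume 0 1 :=
    ⟨h1.1.re, h1.2.re⟩
  rw [recipTransform, re_integral_unit h1, recipValue, ← integral_sub h1' h2,
    ← integral_const_mul]
  refine integral_congr fun t ht => ?_
  rw [Set.uIcc_of_le zero_le_one] at ht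
  obtain ⟨hp0, hp1⟩ := mul_mem_unit hz hz1 ht
  have hNp := kernel_pos (abs_re_div_norm_le z).2 hp0 hp1
  have hPt := hP t ht
  have hre : (1 / (1 - t * z)).re = (1 - t * ‖z‖ * (z.re / ‖z‖)) /
      (1 - 2 * (t * ‖z‖) * (z.re / ‖z‖) + (t * ‖z‖) ^ 2) := by
    rw [one_div, Complex.inv_re, normSq_one_sub_mul hz]
    congr 1
    simp
    field_simp
  simp only [hre]
  generalize z.re / ‖z‖ = c at hNp ⊢
  generalize hn : 1 - 2 * (t * ‖z‖) * c + (t * ‖z‖) ^ 2 = n at hNp ⊢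
  field_simp
  subst hn
  ring

/-- By `recipValue_eq` both terms on the right carry the weight `-log t` against a nonnegative
kernel difference; then `-log t ≥ 1 - t`. -/
theorem le_re_sqRecipTransform_sub {z : ℂ} (hz : 0 < ‖z‖) (hz1 : ‖z‖ < 1) :
    ∫ t in (0 : ℝ)..1, (1 - t) * (t * ‖z‖) / (1 + t * ‖z‖) ^ 2 *
        (1 + (1 + z.re / ‖z‖) * (1 - (t * ‖z‖) ^ 2) /
          (1 - 2 * (t * ‖z‖) * (z.re / ‖z‖) + (t * ‖z‖) ^ 2)) ≤
      (sqRecipTransform z).re - recipValue ‖z‖ := by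
  have h1 := continuousOn_const_div_one_sub_pow hz1 (-1) 1
  simp only [pow_one] at h1
  have hP : ∀ t ∈ Set.Icc (0 : ℝ) 1, 1 + t * ‖z‖ ≠ 0 := fun t ht => by
    have := (mul_mem_unit hz hz1 ht).1
    positivity
  have hN : ∀ t ∈ Set.Icc (0 : ℝ) 1,
      0 < 1 - 2 * (t * ‖z‖) * (z.re / ‖z‖) + (t * ‖z‖) ^ 2 := fun t ht =>
    kernel_pos (abs_re_div_norm_le z).2 (mul_mem_unit hz hz1 ht).1 (mul_mem_unit hz hz1 ht).2
  have h2 : ContinuousOn (fun t : ℝ => -1 / (1 + t * ‖z‖) ^ 2) (Set.Icc 0 1) :=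
    ContinuousOn.div (by fun_prop) (by fun_prop) fun t ht => pow_ne_zero 2 (hP t ht)
  have hi1 := intervalIntegrable_log_mul h1
  have hi1' : IntervalIntegrable (fun t : ℝ => (Real.log t • (-1 / (1 - t * z))).re)
    MeasureTheory.volume 0 1 := ⟨hi1.1.re, hi1.2.re⟩
  have hi2 := intervalIntegrable_log_mul h2
  have hi3 : IntervalIntegrable (fun t : ℝ => (1 - t) * (t * ‖z‖) / (1 + t * ‖z‖) ^ 2 *
        (1 + (1 + z.re / ‖z‖) * (1 - (t * ‖z‖) ^ 2) /
          (1 - 2 * (t * ‖z‖) * (z.re / ‖z‖) + (t * ‖z‖) ^ 2))) MeasureTheory.volume 0 1 :=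
    ContinuousOn.intervalIntegrable_of_Icc zero_le_one
      ((ContinuousOn.div (by fun_prop) (by fun_prop) fun t ht => pow_ne_zero 2 (hP t ht)).mul
      (continuousOn_const.add (ContinuousOn.div (by fun_prop) (by fun_prop)
        fun t ht => (hN t ht).ne')))
  rw [sqRecipTransform, re_integral_unit hi1, recipValue_eq hz.le hz1, ← integral_sub hi1' hi2]
  refine integral_mono_on zero_le_one hi3 (hi1'.sub hi2) fun t ht => ?_
  obtain ⟨hp0, hp1⟩ := mul_mem_unit hz hz1 ht
  have hNp := hN t ht
  have hPt := hP t ht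
  have hre : (Real.log t • (-1 / (1 - t * z))).re = -Real.log t *
      ((1 - t * ‖z‖ * (z.re / ‖z‖)) /
        (1 - 2 * (t * ‖z‖) * (z.re / ‖z‖) + (t * ‖z‖) ^ 2)) := by
    rw [Complex.smul_re, neg_div, one_div, Complex.neg_re, Complex.inv_re,
      normSq_one_sub_mul hz, smul_eq_mul, mul_neg, neg_mul]
    congr 3
    simp
    field_simp
  have hc := abs_re_div_norm_le z
  rw [hre]
  generalize z.re / ‖z‖ = c at hNp hc ⊢
  have hexp : -Real.log t * ((1 - t * ‖z‖ * c) / (1 - 2 * (t * ‖z‖) * c + (t * ‖z‖) ^ 2)) -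
      Real.log t • (-1 / (1 + t * ‖z‖) ^ 2) = -Real.log t * ((t * ‖z‖) / (1 + t * ‖z‖) ^ 2 *
        (1 + (1 + c) * (1 - (t * ‖z‖) ^ 2) / (1 - 2 * (t * ‖z‖) * c + (t * ‖z‖) ^ 2))) := by
    rw [smul_eq_mul]
    generalize hn : 1 - 2 * (t * ‖z‖) * c + (t * ‖z‖) ^ 2 = n at hNp ⊢
    field_simp
    subst hn
    ring
  rw [hexp, mul_div_assoc, mul_assoc]
  rcases ht.1.eq_or_lt with h0 | h0
  · simp [← h0]
  refine mul_le_mul_of_nonneg_right ?_ ?_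
  · linarith [Real.log_le_sub_one_of_pos h0]
  · have h1 : 0 ≤ 1 + c := by linarith
    have h2 : 0 ≤ 1 - (t * ‖z‖) ^ 2 := by nlinarith
    positivity

/-- After the integration by parts in `recipTransform_eq`, the kernels combine to `-t log t · z/(1 -
tz)²`. -/
theorem im_recipTransform_sub {z : ℂ} (hz : 0 < ‖z‖) (hz1 : ‖z‖ < 1) :
    (recipTransform z - sqRecipTransform z).im =
      z.im / ‖z‖ * ∫ t in (0 : ℝ)..1, Real.negMulLog t * ‖z‖ * (1 - (t * ‖z‖) ^ 2) /
        (1 - 2 * (t * ‖z‖) * (z.re / ‖z‖) + (t * ‖z‖) ^ 2) ^ 2 := by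
  have h1 := continuousOn_const_div_one_sub_pow hz1 (-1) 1
  simp only [pow_one] at h1
  have hi1 := intervalIntegrable_log_mul h1
  have hi2 := intervalIntegrable_log_mul (continuousOn_const_div_one_sub_pow hz1 (-1) 2)
  rw [recipTransform_eq hz1, sqRecipTransform, ← integral_sub hi2 hi1,
    im_integral_unit (hi2.sub hi1), ← integral_const_mul]
  refine integral_congr fun t ht => ?_
  rw [Set.uIcc_of_le zero_le_one] at ht
  have hne := one_sub_mul_ne_zero hz1 ht
  have hn0 : Complex.normSq (1 - t * z) ≠ 0 := by simpa using hne
  have hsq : ‖z‖ ^ 2 = z.re ^ 2 + z.im ^ 2 := by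
    rw [← Complex.normSq_eq_norm_sq, Complex.normSq_apply]; ring
  have hform : Real.log t • (-1 / (1 - t * z) ^ 2) - Real.log t • (-1 / (1 - t * z)) =
      ((-Real.log t * t / Complex.normSq (1 - t * z) ^ 2 : ℝ) : ℂ) *
        (z * (starRingEnd ℂ (1 - t * z)) ^ 2) := by
    have hcn : (Complex.normSq (1 - t * z) : ℂ) = (1 - t * z) * starRingEnd ℂ (1 - t * z) :=
      (Complex.mul_conj _).symm
    have hc0 : starRingEnd ℂ (1 - t * z) ≠ 0 := (map_ne_zero _).2 hne
    rw [Complex.real_smul, Complex.real_smul]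
    push_cast
    rw [hcn]
    generalize starRingEnd ℂ (1 - t * z) = w at hc0 ⊢
    field_simp
    ring
  simp only [hform, Complex.im_ofReal_mul]
  have him : (z * (starRingEnd ℂ (1 - t * z)) ^ 2).im = z.im * (1 - (t * ‖z‖) ^ 2) := by
    rw [mul_pow, hsq]
    simp [pow_two]
    ring
  rw [him, normSq_one_sub_mul hz, Real.negMulLog]
  field_simp

/-- The pointwise inequality behind starlikeness of convolutions with the dilogarithm. -/
theorem norm_recipTransform_sub_le {z : ℂ} (hz1 : ‖z‖ < 1) :
    ‖recipTransform z - sqRecipTransform z‖ ≤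
      (recipTransform z + sqRecipTransform z).re - 2 * recipValue ‖z‖ := by
  rcases (norm_nonneg z).eq_or_lt with h0 | hz
  · have : z = 0 := norm_eq_zero.1 h0.symm
    subst this
    simp only [recipTransform, sqRecipTransform, recipValue, mul_zero, sub_zero, norm_zero,
      div_one, add_zero, integral_const, Complex.real_smul, mul_neg, mul_one,
      intervalIntegral.integral_neg, intervalIntegral.integral_ofReal, integral_log]
    norm_num
  obtain ⟨hc, hc1⟩ := abs_re_div_norm_le z
  have hA := re_recipTransform_sub hz hz1
  have hE := le_re_sqRecipTransform_sub hz hz1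
  have hI := im_recipTransform_sub hz hz1
  have hCS := sq_integral_log_kernel_le hz hz1 hc1
  have hK := integral_kernel_cube_le hz hz1 hc hc1
  have hA0 : 0 ≤ ∫ t in (0 : ℝ)..1, t * ‖z‖ * (1 - t * ‖z‖) /
        ((1 + t * ‖z‖) * (1 - 2 * (t * ‖z‖) * (z.re / ‖z‖) + (t * ‖z‖) ^ 2)) := by
    refine integral_nonneg zero_le_one fun t ht => ?_
    obtain ⟨hp0, hp1⟩ := mul_mem_unit hz hz1 ht
    have hNp := kernel_pos hc1 hp0 hp1
    have h3 : 0 ≤ 1 - t * ‖z‖ := by linarith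
    positivity
  have hE0 : 0 ≤ ∫ t in (0 : ℝ)..1, (1 - t) * (t * ‖z‖) / (1 + t * ‖z‖) ^ 2 *
        (1 + (1 + z.re / ‖z‖) * (1 - (t * ‖z‖) ^ 2) /
          (1 - 2 * (t * ‖z‖) * (z.re / ‖z‖) + (t * ‖z‖) ^ 2)) := by
    refine integral_nonneg zero_le_one fun t ht => ?_
    obtain ⟨hp0, hp1⟩ := mul_mem_unit hz hz1 ht
    have hNp := kernel_pos hc1 hp0 hp1
    have h1 : 0 ≤ 1 + z.re / ‖z‖ := by linarith
    have h2 : 0 ≤ 1 - (t * ‖z‖) ^ 2 := by nlinarith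
    have h3 : 0 ≤ 1 - t := by linarith [ht.2]
    positivity
  have him : (z.im / ‖z‖) ^ 2 = (1 + z.re / ‖z‖) * (1 - z.re / ‖z‖) := by
    have hsq : ‖z‖ ^ 2 = z.re ^ 2 + z.im ^ 2 := by
      rw [← Complex.normSq_eq_norm_sq, Complex.normSq_apply]; ring
    field_simp
    linarith
  generalize (∫ t in (0 : ℝ)..1, t * ‖z‖ * (1 - t * ‖z‖) /
        ((1 + t * ‖z‖) * (1 - 2 * (t * ‖z‖) * (z.re / ‖z‖) + (t * ‖z‖) ^ 2))) = A at *
  generalize (∫ t in (0 : ℝ)..1, (1 - t) * (t * ‖z‖) / (1 + t * ‖z‖) ^ 2 *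
        (1 + (1 + z.re / ‖z‖) * (1 - (t * ‖z‖) ^ 2) /
          (1 - 2 * (t * ‖z‖) * (z.re / ‖z‖) + (t * ‖z‖) ^ 2))) = E at *
  generalize (∫ t in (0 : ℝ)..1, ‖z‖ * (1 - t) ^ 2 * (1 - t * ‖z‖) * (1 + t * ‖z‖) ^ 3 /
        (1 - 2 * (t * ‖z‖) * (z.re / ‖z‖) + (t * ‖z‖) ^ 2) ^ 3) = K at *
  generalize (∫ t in (0 : ℝ)..1, Real.negMulLog t * ‖z‖ * (1 - (t * ‖z‖) ^ 2) /
        (1 - 2 * (t * ‖z‖) * (z.re / ‖z‖) + (t * ‖z‖) ^ 2) ^ 2) = C at *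
  -- With `a`, `e` the two real parts less `recipValue ‖z‖`, the goal `(a - e)² + Im² ≤ (a + e)²` is
  -- this bound `Im² ≤ 4ae`.
  have him2 : (recipTransform z - sqRecipTransform z).im ^ 2 ≤
      4 * ((recipTransform z).re - recipValue ‖z‖) *
        ((sqRecipTransform z).re - recipValue ‖z‖) := by
    rw [hI, mul_pow, him, hA]
    have h1 : 0 ≤ 1 + z.re / ‖z‖ := by linarith
    have h2 : 0 ≤ 1 - z.re / ‖z‖ := by linarith
    calc (1 + z.re / ‖z‖) * (1 - z.re / ‖z‖) * C ^ 2
        ≤ (1 + z.re / ‖z‖) * (1 - z.re / ‖z‖) * (A * K) := by gcongr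
      _ = (1 + z.re / ‖z‖) * A * ((1 - z.re / ‖z‖) * K) := by ring
      _ ≤ (1 + z.re / ‖z‖) * A * (4 * ((sqRecipTransform z).re - recipValue ‖z‖)) :=
        mul_le_mul_of_nonneg_left (by linarith) (mul_nonneg h1 hA0)
      _ = _ := by ring
  have ha : 0 ≤ (recipTransform z).re - recipValue ‖z‖ := by
    rw [hA]
    exact mul_nonneg (by linarith) hA0
  refine le_of_sq_le_sq ?_ (by rw [Complex.add_re]; linarith)
  rw [← Complex.normSq_eq_norm_sq, Complex.normSq_apply]
  rw [Complex.sub_im] at him2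
  simp only [Complex.sub_re, Complex.sub_im, Complex.add_re]
  nlinarith

end Pascu

/-! ### Termwise integration, power series of the transforms, and moment measures -/

namespace Pascu

open MeasureTheory

theorem hasSum_of_forall_eq {f g : ℕ → ℂ} {a : ℂ} (h : HasSum f a) (e : ∀ n, g n = f n) :
    HasSum g a := by
  rwa [funext e]

/-- Dominated convergence with majorant `‖w‖ ∑ ‖aₙ‖ qⁿ`; it serves the transforms, the Fourier
integrals and the double integrals alike. -/
theorem integrable_and_hasSum_integral {X : Type*} [MeasurableSpace X] {μ : Measure X} {w ζ : X → ℂ}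
    (hw : Integrable w μ) (hζ : AEStronglyMeasurable ζ μ) {q : ℝ}
    (hq : ∀ᵐ x ∂μ, ‖ζ x‖ ≤ q) {a : ℕ → ℂ} (ha : Summable fun n => ‖a n‖ * q ^ n) {U : ℂ → ℂ}
    (hU : ∀ z, ‖z‖ ≤ q → HasSum (fun n => a n * z ^ n) (U z)) :
    Integrable (fun x => w x * U (ζ x)) μ ∧
      HasSum (fun n => a n * ∫ x, w x * ζ x ^ n ∂μ) (∫ x, w x * U (ζ x) ∂μ) := by
  have hlim : ∀ᵐ x ∂μ, HasSum (fun n => w x * (a n * ζ x ^ n)) (w x * U (ζ x)) := by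
    filter_upwards [hq] with x hx using (hU _ hx).mul_left _
  have hmeas : ∀ n, AEStronglyMeasurable (fun x => w x * (a n * ζ x ^ n)) μ := fun n =>
    hw.1.mul ((hζ.pow n).const_mul (a n))
  have hb : ∀ n, ∀ᵐ x ∂μ, ‖w x * (a n * ζ x ^ n)‖ ≤ ‖w x‖ * (‖a n‖ * q ^ n) := by
    intro n
    filter_upwards [hq] with x hx
    rw [norm_mul, norm_mul, norm_pow]
    gcongr
  have hs := hasSum_integral_of_dominated_convergence (fun n x => ‖w x‖ * (‖a n‖ * q ^ n)) hmeas hb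
    (Filter.Eventually.of_forall fun x => ha.mul_left _)
    (by simp only [tsum_mul_left]; exact hw.norm.mul_const _) hlim
  constructor
  · refine Integrable.mono' (hw.norm.mul_const (∑' n, ‖a n‖ * q ^ n)) ?_ ?_
    · refine aestronglyMeasurable_of_tendsto_ae Filter.atTop
        (f := fun N x => ∑ n ∈ Finset.range N, w x * (a n * ζ x ^ n))
        (fun N => Finset.aestronglyMeasurable_fun_sum _ fun n _ => hmeas n) ?_
      filter_upwards [hlim] with x hx using hx.tendsto_sum_nat
    · filter_upwards [hq, hlim] with x hx hl
      rw [norm_mul, ← (hU _ hx).tsum_eq]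
      gcongr
      refine tsum_of_norm_bounded ha.hasSum fun n => ?_
      rw [norm_mul, norm_pow]
      gcongr
  · refine hasSum_of_forall_eq hs fun n => ?_
    rw [← integral_const_mul]
    congr 1
    ext x
    ring

theorem hasSum_integral_div_one_sub {μ : Measure ℝ} {w : ℝ → ℂ} (hw : Integrable w μ)
    (hμ : ∀ᵐ t ∂μ, t ∈ Set.Icc (0 : ℝ) 1) {z : ℂ} (hz : ‖z‖ < 1) :
    HasSum (fun n => (∫ t, w t * (t : ℂ) ^ n ∂μ) * z ^ n) (∫ t, w t / (1 - t * z) ∂μ) := by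
  have h := (integrable_and_hasSum_integral (ζ := fun t : ℝ => (t : ℂ) * z) hw
    (by fun_prop) (q := ‖z‖) (by
      filter_upwards [hμ] with t ht
      rw [norm_mul, Complex.norm_real, Real.norm_of_nonneg ht.1]
      exact mul_le_of_le_one_left (norm_nonneg z) ht.2)
    (a := fun _ => 1) (by simpa using summable_geometric_of_lt_one (norm_nonneg z) hz)
    (U := fun z => (1 - z)⁻¹)
    (fun y hy => by simpa using hasSum_geometric_of_norm_lt_one (hy.trans_lt hz))).2
  simp only [one_mul, mul_pow, ← mul_assoc, integral_mul_const] at h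
  simpa only [div_eq_mul_inv] using h

theorem integral_pow_mul_log (n : ℕ) :
    ∫ t in (0 : ℝ)..1, Real.log t * t ^ n = -1 / ((n : ℝ) + 1) ^ 2 := by
  have hn : (n : ℝ) + 1 ≠ 0 := by positivity
  have := intervalIntegral.integral_eq_sub_of_hasDerivAt_of_le (a := (0 : ℝ)) (b := 1) zero_le_one
    -- Grouping `t * Real.log t` gives continuity at the endpoint `0`.
    (f := fun t : ℝ => t ^ n * (t * Real.log t) / (n + 1) - t ^ (n + 1) / ((n : ℝ) + 1) ^ 2)
    (f' := fun t : ℝ => Real.log t * t ^ n)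
    ((((continuous_pow n).mul Real.continuous_mul_log).div_const _).sub
      ((continuous_pow (n + 1)).div_const _)).continuousOn
    (fun t ht => by
      have h0 := ht.1.ne'
      have d0 := Real.hasDerivAt_log h0
      have d1 : HasDerivAt (fun t : ℝ => t ^ (n + 1)) ((n + 1) * t ^ n) t := by
        simpa using hasDerivAt_pow (n + 1) t
      have d2 := ((d1.mul d0).div_const ((n : ℝ) + 1)).sub
        (d1.div_const (((n : ℝ) + 1) ^ 2))
      refine (d2.congr_of_eventuallyEq (Filter.Eventually.of_forall fun s => ?_)).congr_deriv ?_
      · simp only [Pi.sub_apply, Pi.mul_apply]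
        ring
      · field_simp
        ring)
    (intervalIntegrable_log_mul (continuous_pow n).continuousOn)
  rw [this]
  simp
  ring

theorem hasSum_recipTransform {z : ℂ} (hz : ‖z‖ < 1) :
    HasSum (fun n : ℕ => 1 / ((n : ℂ) + 1) * z ^ n) (recipTransform z) := by
  have h := hasSum_integral_div_one_sub (μ := volume.restrict (Set.Ioc 0 1)) (w := fun _ => 1)
    (integrable_const _)
    ((ae_restrict_mem measurableSet_Ioc).mono fun t ht => Set.Ioc_subset_Icc_self ht) hz
  rw [recipTransform, intervalIntegral.integral_of_le zero_le_one]
  refine hasSum_of_forall_eq h fun n => ?_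
  rw [← intervalIntegral.integral_of_le zero_le_one]
  simp only [one_mul, ← Complex.ofReal_pow, intervalIntegral.integral_ofReal, integral_pow]
  simp

theorem hasSum_sqRecipTransform {z : ℂ} (hz : ‖z‖ < 1) :
    HasSum (fun n : ℕ => 1 / ((n : ℂ) + 1) ^ 2 * z ^ n) (sqRecipTransform z) := by
  have hi : Integrable (fun t : ℝ => -(Real.log t : ℂ)) (volume.restrict (Set.Ioc 0 1)) :=
    (intervalIntegral.intervalIntegrable_log' (a := 0) (b := 1)).1.ofReal.neg
  have h := hasSum_integral_div_one_sub hi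
    ((ae_restrict_mem measurableSet_Ioc).mono fun t ht => Set.Ioc_subset_Icc_self ht) hz
  rw [sqRecipTransform, intervalIntegral.integral_of_le zero_le_one]
  have hw : (fun t : ℝ => Real.log t • (-1 / (1 - t * z))) =
      fun t : ℝ => -(Real.log t : ℂ) / (1 - t * z) := by
    ext t
    rw [Complex.real_smul]
    ring
  rw [hw]
  refine hasSum_of_forall_eq h fun n => ?_
  rw [← intervalIntegral.integral_of_le zero_le_one]
  congr 1
  have := integral_pow_mul_log n
  rw [← Complex.ofReal_inj, ← intervalIntegral.integral_ofReal] at this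
  push_cast at this
  simp only [neg_mul, intervalIntegral.integral_neg]
  rw [this]
  ring

/-- The ratio equals `κ/m + (1 - κ/m)/(1 + mn)`: a mixture of the point mass at `1` and the law of
`s^m` for `s` uniform on `[0,1]`. -/
theorem exists_measure_moments {κ m : ℝ} (hκ : 0 ≤ κ) (hm : 0 < m) (hκm : κ ≤ m) :
    ∃ τ : Measure ℝ, IsProbabilityMeasure τ ∧ (∀ᵐ s ∂τ, s ∈ Set.Icc (0 : ℝ) 1) ∧
      ∀ n : ℕ, ∫ s, s ^ n ∂τ = (1 + κ * n) / (1 + m * n) := by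
  have hmeas : Measurable fun s : ℝ => s ^ m := by fun_prop
  set σ : Measure ℝ := (volume.restrict (Set.Ioc (0 : ℝ) 1)).map fun s : ℝ => s ^ m with hσ
  have : IsProbabilityMeasure (volume.restrict (Set.Ioc (0 : ℝ) 1)) := ⟨by simp⟩
  have : IsProbabilityMeasure σ := Measure.isProbabilityMeasure_map hmeas.aemeasurable
  have hσI : ∀ᵐ s ∂σ, s ∈ Set.Icc (0 : ℝ) 1 := by
    refine (ae_map_iff (p := fun s => s ∈ Set.Icc (0 : ℝ) 1) hmeas.aemeasurable
      measurableSet_Icc).2 ?_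
    filter_upwards [ae_restrict_mem measurableSet_Ioc] with s hs
    exact ⟨Real.rpow_nonneg hs.1.le _, Real.rpow_le_one hs.1.le hs.2 hm.le⟩
  have hσm : ∀ n : ℕ, ∫ s, s ^ n ∂σ = 1 / (1 + m * n) := by
    intro n
    have hn : (0 : ℝ) ≤ m * n := by positivity
    rw [hσ, integral_map hmeas.aemeasurable (by fun_prop), ← intervalIntegral.integral_of_le zero_le_one]
    have : ∫ s in (0 : ℝ)..1, (s ^ m) ^ n = ∫ s in (0 : ℝ)..1, s ^ (m * n) :=
      intervalIntegral.integral_congr fun s hs => by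
        rw [Set.uIcc_of_le zero_le_one] at hs
        simp only [Real.rpow_mul_natCast hs.1]
    rw [this, integral_rpow (Or.inl (by linarith)), Real.one_rpow,
      Real.zero_rpow (by positivity), sub_zero, add_comm]
  have hd : ∀ᵐ s ∂Measure.dirac (1 : ℝ), s ∈ Set.Icc (0 : ℝ) 1 := by
    refine (ae_dirac_iff (p := fun s => s ∈ Set.Icc (0 : ℝ) 1) measurableSet_Icc).2 ?_
    simp
  have ha0 : 0 ≤ κ / m := by positivity
  have ha1 : 0 ≤ 1 - κ / m := sub_nonneg.2 (div_le_one_of_le₀ hκm hm.le)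
  refine ⟨ENNReal.ofReal (κ / m) • Measure.dirac 1 + ENNReal.ofReal (1 - κ / m) • σ,
    ⟨?_⟩, ?_, fun n => ?_⟩
  · simp [← ENNReal.ofReal_add ha0 ha1]
  · rw [ae_add_measure_iff]
    exact ⟨Measure.ae_smul_measure hd _, Measure.ae_smul_measure hσI _⟩
  · have hint : ∀ (ρ : Measure ℝ) [IsFiniteMeasure ρ], (∀ᵐ s ∂ρ, s ∈ Set.Icc (0 : ℝ) 1) →
        Integrable (fun s => s ^ n) ρ := fun ρ _ hρ =>
      Integrable.of_bound (by fun_prop) 1 (by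
        filter_upwards [hρ] with s hs
        rw [norm_pow, Real.norm_of_nonneg hs.1]
        exact pow_le_one₀ hs.1 hs.2)
    rw [integral_add_measure ((hint _ hd).smul_measure ENNReal.ofReal_ne_top)
      ((hint _ hσI).smul_measure ENNReal.ofReal_ne_top), integral_smul_measure,
      integral_smul_measure, integral_dirac, hσm, ENNReal.toReal_ofReal ha0,
      ENNReal.toReal_ofReal ha1]
    have : 1 + m * (n : ℝ) ≠ 0 := by positivity
    simp only [one_pow, smul_eq_mul]
    field_simp
    ring

/-- The law of a product of independent variables has the product moments. -/
theorem exists_measure_moments_mul {c d : ℕ → ℝ} {τ₁ τ₂ : Measure ℝ} [IsProbabilityMeasure τ₁]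
    [IsProbabilityMeasure τ₂] (h₁ : ∀ᵐ s ∂τ₁, s ∈ Set.Icc (0 : ℝ) 1)
    (h₂ : ∀ᵐ s ∂τ₂, s ∈ Set.Icc (0 : ℝ) 1) (hc : ∀ n, ∫ s, s ^ n ∂τ₁ = c n)
    (hd : ∀ n, ∫ s, s ^ n ∂τ₂ = d n) :
    ∃ τ : Measure ℝ, IsProbabilityMeasure τ ∧ (∀ᵐ s ∂τ, s ∈ Set.Icc (0 : ℝ) 1) ∧
      ∀ n, ∫ s, s ^ n ∂τ = c n * d n := by
  have hmeas : Measurable fun p : ℝ × ℝ => p.1 * p.2 := by fun_prop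
  refine ⟨(τ₁.prod τ₂).map fun p => p.1 * p.2,
    Measure.isProbabilityMeasure_map hmeas.aemeasurable, ?_, fun n => ?_⟩
  · refine (ae_map_iff (p := fun s => s ∈ Set.Icc (0 : ℝ) 1) hmeas.aemeasurable
      measurableSet_Icc).2 ?_
    filter_upwards [Measure.quasiMeasurePreserving_fst.ae h₁,
      Measure.quasiMeasurePreserving_snd.ae h₂] with p hp hp'
    exact ⟨mul_nonneg hp.1 hp'.1, mul_le_one₀ hp.2 hp'.1 hp'.2⟩
  · rw [integral_map hmeas.aemeasurable (by fun_prop)]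
    simp only [mul_pow]
    rw [integral_prod_mul (fun s : ℝ => s ^ n) (fun s : ℝ => s ^ n), hc, hd]

end Pascu

/-! ### Fourier coefficients on a circle and the Herglotz measure -/

namespace Pascu

open MeasureTheory

theorem integral_exp_int_mul_I (k : ℤ) :
    ∫ θ in (0 : ℝ)..2 * Real.pi, Complex.exp (k * θ * Complex.I) =
      if k = 0 then ((2 * Real.pi : ℝ) : ℂ) else 0 := by
  split_ifs with h
  · simp [h]
  · have hk : (k : ℂ) * Complex.I ≠ 0 := by simpa using h
    have := integral_exp_mul_complex (a := 0) (b := 2 * Real.pi) hk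
    simp only [mul_right_comm _ Complex.I] at this
    rw [this]
    have h1 : (k : ℂ) * ((2 * Real.pi : ℝ) : ℂ) * Complex.I = k * (2 * Real.pi * Complex.I) := by
      push_cast
      ring
    rw [h1, Complex.exp_int_mul_two_pi_mul_I]
    simp

section Herglotz

variable {H : ℂ → ℂ} {h : ℕ → ℂ} {ρ : ℝ}

/-- The points `ρ exp (iθ)` lie on the circle of radius `ρ`. -/
theorem norm_ofReal_mul_exp (hρ : 0 ≤ ρ) (θ : ℝ) : ‖(ρ : ℂ) * Complex.exp (θ * Complex.I)‖ = ρ := by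
  rw [norm_mul, Complex.norm_exp_ofReal_mul_I, mul_one, Complex.norm_real, Real.norm_of_nonneg hρ]

theorem hasSum_fourier_integral (hH : ∀ z : ℂ, ‖z‖ < 1 → HasSum (fun n => h n * z ^ n) (H z))
    (hρ : 0 ≤ ρ) (hρ1 : ρ < 1) (j : ℤ) :
    HasSum (fun k : ℕ => h k * (ρ : ℂ) ^ k *
        if (k : ℤ) + j = 0 then ((2 * Real.pi : ℝ) : ℂ) else 0)
      (∫ θ in (0 : ℝ)..2 * Real.pi,
        Complex.exp (j * θ * Complex.I) * H (ρ * Complex.exp (θ * Complex.I))) := by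
  have hρn : ‖(ρ : ℂ)‖ = ρ := by rw [Complex.norm_real, Real.norm_of_nonneg hρ]
  have ha : Summable fun n => ‖h n‖ * ρ ^ n := by
    have := (hH ρ (by rwa [hρn])).summable.norm
    simpa only [norm_mul, norm_pow, hρn] using this
  have key := (integrable_and_hasSum_integral
    (μ := volume.restrict (Set.Ioc 0 (2 * Real.pi)))
    (w := fun θ : ℝ => Complex.exp (j * θ * Complex.I))
    (ζ := fun θ : ℝ => (ρ : ℂ) * Complex.exp (θ * Complex.I))
    (Continuous.integrableOn_Ioc (by fun_prop))
    (Continuous.aestronglyMeasurable (by fun_prop))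
    (Filter.Eventually.of_forall fun θ => (norm_ofReal_mul_exp hρ θ).le) ha
    (fun z hz => hH z (hz.trans_lt hρ1))).2
  rw [intervalIntegral.integral_of_le Real.two_pi_pos.le]
  refine hasSum_of_forall_eq key fun k => ?_
  rw [← integral_exp_int_mul_I, intervalIntegral.integral_of_le Real.two_pi_pos.le, mul_assoc,
    ← integral_const_mul]
  congr 2
  ext θ
  rw [mul_pow, ← Complex.exp_nat_mul, mul_left_comm, ← Complex.exp_add]
  congr 3
  push_cast
  ring

theorem fourier_integral_neg (hH : ∀ z : ℂ, ‖z‖ < 1 → HasSum (fun n => h n * z ^ n) (H z))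
    (hρ : 0 ≤ ρ) (hρ1 : ρ < 1) (n : ℕ) :
    ∫ θ in (0 : ℝ)..2 * Real.pi,
        Complex.exp (-n * θ * Complex.I) * H (ρ * Complex.exp (θ * Complex.I)) =
      2 * Real.pi * (h n * ρ ^ n) := by
  have key := hasSum_fourier_integral hH hρ hρ1 (-n)
  have h2 := hasSum_single (f := fun k : ℕ => h k * (ρ : ℂ) ^ k *
        if (k : ℤ) + -n = 0 then ((2 * Real.pi : ℝ) : ℂ) else 0) n fun k hk => by
    have : (k : ℤ) + -n ≠ 0 := by omega
    simp [this]
  have := key.unique h2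
  push_cast at this
  rw [this]
  simp
  ring

theorem fourier_integral_pos (hH : ∀ z : ℂ, ‖z‖ < 1 → HasSum (fun n => h n * z ^ n) (H z))
    (hρ : 0 ≤ ρ) (hρ1 : ρ < 1) {n : ℕ} (hn : n ≠ 0) :
    ∫ θ in (0 : ℝ)..2 * Real.pi,
        Complex.exp (n * θ * Complex.I) * H (ρ * Complex.exp (θ * Complex.I)) = 0 := by
  have key := hasSum_fourier_integral hH hρ hρ1 n
  have h2 : (fun k : ℕ => h k * (ρ : ℂ) ^ k *
        if (k : ℤ) + n = 0 then ((2 * Real.pi : ℝ) : ℂ) else 0) = fun _ => 0 := by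
    ext k
    have : (k : ℤ) + n ≠ 0 := by omega
    simp [this]
  rw [h2] at key
  exact key.unique hasSum_zero

/-- The Herglotz representation, on the circle of radius `ρ`. -/
theorem exists_herglotz_measure {β : ℝ}
    (hH : ∀ z : ℂ, ‖z‖ < 1 → HasSum (fun n => h n * z ^ n) (H z))
    (hcont : ContinuousOn H (Metric.ball 0 1)) (hρ : 0 ≤ ρ) (hρ1 : ρ < 1) (h0 : h 0 = 1)
    (hre : ∀ z : ℂ, ‖z‖ < 1 → β < (H z).re) :
    ∃ m : Measure ℂ, IsFiniteMeasure m ∧ (∀ᵐ ω ∂m, ‖ω‖ = 1) ∧ m.real Set.univ = 1 - β ∧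
      ∀ n ≠ 0, h n * ρ ^ n = 2 * ∫ ω, ω ^ n ∂m := by
  have hcircle : Continuous fun θ : ℝ => H (ρ * Complex.exp (θ * Complex.I)) :=
    hcont.comp_continuous (by fun_prop) fun θ => by
      rw [mem_ball_zero_iff, norm_ofReal_mul_exp hρ]
      exact hρ1
  -- Staying on a circle with `ρ < 1` gives an explicit continuous density, with no weak limit to
  -- take.
  set P : ℝ → ℝ := fun θ => ((H (ρ * Complex.exp (θ * Complex.I))).re - β) / (2 * Real.pi) with hP
  have hPc : Continuous P :=
    ((Complex.continuous_re.comp hcircle).sub continuous_const).div_const _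
  have hP0 : ∀ θ, 0 ≤ P θ := fun θ => by
    have := hre (ρ * Complex.exp (θ * Complex.I)) (by rwa [norm_ofReal_mul_exp hρ])
    have hpi := Real.pi_pos
    simp only [hP]
    exact div_nonneg (by linarith) (by positivity)
  -- The conjugate point, so that the `n`-th moment picks out the `n`-th Taylor coefficient.
  set e : ℝ → ℂ := fun θ => Complex.exp (-θ * Complex.I) with he
  have hec : Continuous e := by fun_prop
  have hen : ∀ θ, ‖e θ‖ = 1 := fun θ => by
    simp only [he]
    rw [← Complex.ofReal_neg, Complex.norm_exp_ofReal_mul_I]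
  set ν : Measure ℝ := (volume.restrict (Set.Ioc 0 (2 * Real.pi))).withDensity
    fun θ => ENNReal.ofReal (P θ) with hν
  have hPi : IntegrableOn P (Set.Ioc 0 (2 * Real.pi)) := hPc.integrableOn_Ioc
  have : IsFiniteMeasure ν := isFiniteMeasure_withDensity_ofReal hPi.2
  have hint : ∀ f : ℝ → ℂ, ∫ θ, f θ ∂ν = ∫ θ in (0 : ℝ)..2 * Real.pi, (P θ : ℂ) * f θ := by
    intro f
    rw [hν, integral_withDensity_eq_integral_toReal_smul (by fun_prop)
      (Filter.Eventually.of_forall fun _ => ENNReal.ofReal_lt_top),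
      intervalIntegral.integral_of_le Real.two_pi_pos.le]
    congr 1
    ext θ
    rw [ENNReal.toReal_ofReal (hP0 θ), Complex.real_smul]
  have hpi : (Real.pi : ℂ) ≠ 0 := by exact_mod_cast Real.pi_ne_zero
  -- For `n ≥ 1` only `H` contributes to the moment: the conjugate term and the constant integrate
  -- to zero. The half in `Re H = (H + conj H)/2` is the source of the factor `2` in the conclusion.
  have hPexp : ∀ θ, (P θ : ℂ) = (H (ρ * Complex.exp (θ * Complex.I)) +
      starRingEnd ℂ (H (ρ * Complex.exp (θ * Complex.I))) - 2 * β) / (4 * Real.pi) := by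
    intro θ
    rw [Complex.add_conj]
    simp only [hP]
    push_cast
    field_simp
    ring
  have hmom : ∀ n : ℕ, ∫ θ, e θ ^ n ∂ν = (2 * Real.pi * (h n * ρ ^ n) +
      starRingEnd ℂ (∫ θ in (0 : ℝ)..2 * Real.pi,
        Complex.exp (n * θ * Complex.I) * H (ρ * Complex.exp (θ * Complex.I))) -
      2 * β * (if n = 0 then ((2 * Real.pi : ℝ) : ℂ) else 0)) / (4 * Real.pi) := by
    intro n
    have c1 : Continuous fun θ : ℝ =>
        Complex.exp (-n * θ * Complex.I) * H (ρ * Complex.exp (θ * Complex.I)) :=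
      Continuous.mul (by fun_prop) hcircle
    have c2 : Continuous fun θ : ℝ => starRingEnd ℂ
        (Complex.exp (n * θ * Complex.I) * H (ρ * Complex.exp (θ * Complex.I))) :=
      Complex.continuous_conj.comp (Continuous.mul (by fun_prop) hcircle)
    have hk := integral_exp_int_mul_I (-n)
    simp only [neg_eq_zero, Nat.cast_eq_zero] at hk
    rw [hint, ← fourier_integral_neg hH hρ hρ1, ← hk,
      intervalIntegral.integral_of_le (f := fun θ : ℝ => Complex.exp (n * θ * Complex.I) * _)
        Real.two_pi_pos.le, ← integral_conj, ← intervalIntegral.integral_of_le Real.two_pi_pos.le,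
      ← intervalIntegral.integral_const_mul,
      ← intervalIntegral.integral_add, ← intervalIntegral.integral_sub,
      ← intervalIntegral.integral_div]
    · congr 1
      ext θ
      rw [hPexp, map_mul, ← Complex.exp_conj]
      simp only [he, ← Complex.exp_nat_mul, map_mul, Complex.conj_I, Complex.conj_ofReal,
        map_natCast]
      push_cast
      ring_nf
    all_goals
      apply Continuous.intervalIntegrable
      first
        | exact c1
        | exact c2
        | exact c1.add c2
        | fun_prop
  refine ⟨ν.map e, inferInstance, ?_, ?_, fun n hn => ?_⟩
  · refine (ae_map_iff (p := fun ω : ℂ => ‖ω‖ = 1) hec.measurable.aemeasurable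
      (measurableSet_eq_fun measurable_norm measurable_const)).2 ?_
    exact Filter.Eventually.of_forall hen
  · have h1 := hmom 0
    have h2 := fourier_integral_neg hH hρ hρ1 0
    simp only [Nat.cast_zero, neg_zero] at h1 h2
    rw [h2, h0] at h1
    simp only [pow_zero, mul_one, if_true, map_mul, Complex.conj_ofReal, integral_const,
      Complex.real_smul, map_ofNat] at h1
    rw [map_measureReal_apply hec.measurable MeasurableSet.univ, Set.preimage_univ,
      ← Complex.ofReal_inj, h1]
    push_cast
    field_simp
    ring
  · rw [integral_map hec.measurable.aemeasurable (by fun_prop), hmom,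
      fourier_integral_pos hH hρ hρ1 hn, if_neg hn]
    simp
    field_simp
    ring

end Herglotz

end Pascu

/-! ### The moment measure of the kernel and the meaning of `β` -/

namespace Pascu

open MeasureTheory

/-- A quantitative decrease, the source of the final strict inequality. Each factor `1 + t·` is at
most `2`, so the integrands differ by at least `t s (1 - q)/4`, and `∫ t = 1/2` gives the `8`. -/
theorem recipValue_add_le {s q : ℝ} (hs : s ∈ Set.Icc (0 : ℝ) 1) (hq : q ∈ Set.Icc (0 : ℝ) 1) :
    recipValue s + s * (1 - q) / 8 ≤ recipValue (q * s) := by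
  have hP : ∀ x : ℝ, 0 ≤ x → ∀ t ∈ Set.Icc (0 : ℝ) 1, 0 < 1 + t * x := fun x hx t ht => by
    have := mul_nonneg ht.1 hx
    positivity
  have hi : ∀ x : ℝ, 0 ≤ x → IntervalIntegrable (fun t : ℝ => 1 / (1 + t * x)) volume 0 1 :=
    fun x hx => ContinuousOn.intervalIntegrable_of_Icc zero_le_one
      (ContinuousOn.div (by fun_prop) (by fun_prop) fun t ht => (hP x hx t ht).ne')
  have hqs := mul_nonneg hq.1 hs.1
  have h : s * (1 - q) / 8 = ∫ t in (0 : ℝ)..1, t * (s * (1 - q) / 4) := by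
    rw [intervalIntegral.integral_mul_const, integral_id]
    ring
  rw [h, recipValue, recipValue, ← intervalIntegral.integral_add (hi s hs.1)
    (Continuous.intervalIntegrable (by fun_prop) _ _)]
  refine intervalIntegral.integral_mono_on zero_le_one
    ((hi s hs.1).add (Continuous.intervalIntegrable (by fun_prop) _ _)) (hi _ hqs) fun t ht => ?_
  have h1 := hP _ hs.1 t ht
  have h2 := hP _ hqs t ht
  have h3 : (1 + t * s) * (1 + t * (q * s)) ≤ 4 := by
    have h4 : 1 + t * s ≤ 2 := by linarith [mul_le_one₀ ht.2 hs.1 hs.2]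
    have h5 : 1 + t * (q * s) ≤ 2 := by
      linarith [mul_le_one₀ ht.2 hqs (mul_le_one₀ hq.2 hs.1 hs.2)]
    nlinarith
  have h6 : 0 ≤ t * s * (1 - q) := mul_nonneg (mul_nonneg ht.1 hs.1) (sub_nonneg.2 hq.2)
  have h7 : 1 / (1 + t * (q * s)) - 1 / (1 + t * s) =
      t * s * (1 - q) / ((1 + t * s) * (1 + t * (q * s))) := by
    rw [div_sub_div _ _ h2.ne' h1.ne', mul_comm (1 + t * (q * s))]
    ring
  have h8 : t * s * (1 - q) / 4 ≤ t * s * (1 - q) / ((1 + t * s) * (1 + t * (q * s))) :=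
    div_le_div_of_nonneg_left h6 (mul_pos h1 h2) h3
  linarith

theorem integrable_one_div_one_add_mul {τ : Measure ℝ} [IsFiniteMeasure τ]
    (hI : ∀ᵐ s ∂τ, s ∈ Set.Icc (0 : ℝ) 1) :
    Integrable (fun p : ℝ × ℝ => 1 / (1 + p.1 * p.2))
      ((volume.restrict (Set.Ioc 0 1)).prod τ) := by
  refine Integrable.of_bound (Measurable.aestronglyMeasurable (by fun_prop)) 1 ?_
  filter_upwards [Measure.quasiMeasurePreserving_snd.ae hI,
    Measure.quasiMeasurePreserving_fst.ae (ae_restrict_mem measurableSet_Ioc)] with p hs ht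
  have : 0 ≤ p.1 * p.2 := mul_nonneg ht.1.le hs.1
  rw [Real.norm_of_nonneg (by positivity)]
  exact div_le_one_of_le₀ (by linarith) (by positivity)

theorem integrable_recipValue {τ : Measure ℝ} [IsFiniteMeasure τ]
    (hI : ∀ᵐ s ∂τ, s ∈ Set.Icc (0 : ℝ) 1) : Integrable recipValue τ := by
  have h := (integrable_one_div_one_add_mul hI).integral_prod_right
  simp only [← intervalIntegral.integral_of_le zero_le_one] at h
  exact h

/-- The coefficients of the convolution kernel relative to the dilogarithm. -/
noncomputable def kernelCoeff (ξ μ ν : ℝ) (n : ℕ) : ℝ :=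
  (1 + ξ * n) * (n + 1) / ((1 + μ * n) * (1 + ν * n))

theorem exists_measure_kernelCoeff {ξ μ ν : ℝ} (hξ0 : 0 ≤ ξ) (hξ1 : ξ ≤ 1) (hμ : 1 ≤ μ)
    (hμν : μ ≤ ν) :
    ∃ τ : Measure ℝ, IsProbabilityMeasure τ ∧ (∀ᵐ s ∂τ, s ∈ Set.Icc (0 : ℝ) 1) ∧
      ∀ n, ∫ s, s ^ n ∂τ = kernelCoeff ξ μ ν n := by
  obtain ⟨τ₁, h₁, hI₁, hm₁⟩ := exists_measure_moments zero_le_one (zero_lt_one.trans_le hμ) hμ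
  obtain ⟨τ₂, h₂, hI₂, hm₂⟩ := exists_measure_moments hξ0
    (zero_lt_one.trans_le (hμ.trans hμν)) (hξ1.trans (hμ.trans hμν))
  obtain ⟨τ, h, hI, hm⟩ := exists_measure_moments_mul hI₁ hI₂ hm₁ hm₂
  refine ⟨τ, h, hI, fun n => ?_⟩
  rw [hm, kernelCoeff, div_mul_div_comm]
  ring

theorem weight_eq_tsum {ξ μ ν t : ℝ} (hμ : 1 ≤ μ) (hμν : μ ≤ ν) (ht0 : 0 ≤ t) (ht1 : t < 1) :
    (1 - ξ) * g μ ν t + ξ * (2 * q μ ν t - 1) =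
      2 * ∑' n, kernelCoeff ξ μ ν n * (-t) ^ n - 1 := by
  have hden : ∀ n : ℕ, ((n : ℝ) + 1) ^ 2 ≤ (1 + μ * n) * (1 + ν * n) := fun n => by
    rw [pow_two]
    have hn : (0 : ℝ) ≤ n := n.cast_nonneg
    have h1 : (n : ℝ) + 1 ≤ 1 + μ * n := by nlinarith
    have h2 : (n : ℝ) + 1 ≤ 1 + ν * n := by nlinarith [hμ.trans hμν]
    gcongr
  have hpos : ∀ n : ℕ, 0 < (1 + μ * n) * (1 + ν * n) := fun n => by
    have : (0 : ℝ) < ((n : ℝ) + 1) ^ 2 := by positivity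
    exact this.trans_le (hden n)
  have hq : Summable fun n : ℕ =>
      ((n : ℝ) + 1) ^ 2 * (-1) ^ n * t ^ n / ((1 + μ * n) * (1 + ν * n)) := by
    refine Summable.of_norm_bounded (summable_geometric_of_lt_one ht0 ht1) fun n => ?_
    rw [norm_div, Real.norm_of_nonneg (hpos n).le, norm_mul, norm_mul, norm_pow, norm_pow,
      norm_pow, norm_neg, norm_one, one_pow, mul_one, Real.norm_of_nonneg ht0,
      Real.norm_of_nonneg (by positivity : (0 : ℝ) ≤ n + 1), div_le_iff₀ (hpos n), mul_comm]
    exact mul_le_mul_of_nonneg_left (hden n) (by positivity)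
  have hg : Summable fun n : ℕ =>
      ((n : ℝ) + 1) * (-1) ^ n * t ^ n / ((1 + μ * n) * (1 + ν * n)) := by
    refine Summable.of_norm_bounded hq.norm fun n => ?_
    simp only [norm_div, norm_mul]
    rw [norm_pow ((n : ℝ) + 1) 2]
    have h1 : 1 ≤ ‖(n : ℝ) + 1‖ := by
      rw [Real.norm_of_nonneg (by positivity)]
      linarith [(n.cast_nonneg : (0 : ℝ) ≤ n)]
    gcongr
    exact le_self_pow₀ h1 two_ne_zero
  have hsum := (hg.hasSum.mul_left (1 - ξ)).add (hq.hasSum.mul_left ξ)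
  have heq : ∀ n : ℕ, kernelCoeff ξ μ ν n * (-t) ^ n =
      (1 - ξ) * (((n : ℝ) + 1) * (-1) ^ n * t ^ n / ((1 + μ * n) * (1 + ν * n))) +
      ξ * (((n : ℝ) + 1) ^ 2 * (-1) ^ n * t ^ n / ((1 + μ * n) * (1 + ν * n))) := by
    intro n
    rw [kernelCoeff, neg_pow]
    have := (hpos n).ne'
    field_simp
    ring
  rw [funext heq, hsum.tsum_eq, g, q]
  ring

/-- For `t < 1` the alternating series is `∫ 1/(1 + ts) dτ(s)`, and Fubini turns its `t`-integral
into that of `recipValue`. -/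
theorem integral_weight {ξ μ ν : ℝ} (hμ : 1 ≤ μ) (hμν : μ ≤ ν) {τ : Measure ℝ}
    [IsProbabilityMeasure τ] (hI : ∀ᵐ s ∂τ, s ∈ Set.Icc (0 : ℝ) 1)
    (hm : ∀ n, ∫ s, s ^ n ∂τ = kernelCoeff ξ μ ν n) :
    ∫ t in (0 : ℝ)..1, (1 - ξ) * g μ ν t + ξ * (2 * q μ ν t - 1) =
      2 * ∫ s, recipValue s ∂τ - 1 := by
  have hprod := integrable_one_div_one_add_mul hI
  have hpt : ∀ t ∈ Set.Ioo (0 : ℝ) 1, (1 - ξ) * g μ ν t + ξ * (2 * q μ ν t - 1) =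
      2 * ∫ s, 1 / (1 + t * s) ∂τ - 1 := by
    intro t ht
    rw [weight_eq_tsum hμ hμν ht.1.le ht.2]
    congr 2
    have hz : ‖(-t : ℂ)‖ < 1 := by
      rw [norm_neg, Complex.norm_real, Real.norm_of_nonneg ht.1.le]
      exact ht.2
    have hs := (hasSum_integral_div_one_sub (w := fun _ => 1) (integrable_const _) hI hz).tsum_eq
    rw [← Complex.ofReal_inj, Complex.ofReal_tsum, ← integral_complex_ofReal]
    have hl : (fun n : ℕ => ((kernelCoeff ξ μ ν n * (-t) ^ n : ℝ) : ℂ)) =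
        fun n => (∫ s, 1 * (s : ℂ) ^ n ∂τ) * (-t : ℂ) ^ n := by
      ext n
      rw [← hm, Complex.ofReal_mul, ← integral_complex_ofReal]
      simp
    have hr : (fun s : ℝ => ((1 / (1 + t * s) : ℝ) : ℂ)) = fun s : ℝ => 1 / (1 - s * (-t : ℂ)) := by
      ext s
      push_cast
      ring
    rw [hl, hr, hs]
  -- The endpoint `t = 1` is dropped because the series may diverge there, where `tsum` takes a
  -- default value.
  rw [intervalIntegral.integral_of_le zero_le_one, integral_Ioc_eq_integral_Ioo,
    setIntegral_congr_fun measurableSet_Ioo hpt, ← integral_Ioc_eq_integral_Ioo,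
    integral_sub (hprod.integral_prod_left.const_mul 2) (integrable_const _),
    integral_const_mul, integral_integral_swap hprod]
  simp [recipValue, intervalIntegral.integral_of_le]

end Pascu

/-! ### Taylor coefficients and the double integral representation -/

namespace Pascu

open MeasureTheory

/-- The Taylor coefficients at the origin. -/
noncomputable def taylorCoeff (f : ℂ → ℂ) (n : ℕ) : ℂ := iteratedDeriv n f 0 / n.factorial

theorem differentiableOn_iteratedDeriv {f : ℂ → ℂ} (hf : DifferentiableOn ℂ f (Metric.ball 0 1))
    (k : ℕ) : DifferentiableOn ℂ (iteratedDeriv k f) (Metric.ball 0 1) := by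
  induction k with
  | zero => simpa using hf
  | succ k ih =>
    rw [iteratedDeriv_succ]
    exact ih.deriv Metric.isOpen_ball

theorem hasSum_pow_mul_iteratedDeriv {f : ℂ → ℂ} (hf : DifferentiableOn ℂ f (Metric.ball 0 1))
    (k : ℕ) {z : ℂ} (hz : ‖z‖ < 1) :
    HasSum (fun n => n.descFactorial k * taylorCoeff f n * z ^ n)
      (z ^ k * iteratedDeriv k f z) := by
  have h := (Complex.hasSum_taylorSeries_on_ball (differentiableOn_iteratedDeriv hf k)
    (mem_ball_zero_iff.2 hz)).mul_left (z ^ k)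
  rw [← hasSum_nat_add_iff' k]
  have h0 : ∑ i ∈ Finset.range k, ((i.descFactorial k : ℕ) : ℂ) * taylorCoeff f i * z ^ i = 0 :=
    Finset.sum_eq_zero fun i hi => by
      rw [Nat.descFactorial_of_lt (Finset.mem_range.1 hi)]
      simp
  rw [h0, sub_zero]
  refine hasSum_of_forall_eq h fun n => ?_
  have hfac : (n.factorial : ℂ) * ((n + k).descFactorial k : ℕ) = (n + k).factorial := by
    have := Nat.factorial_mul_descFactorial (Nat.le_add_left k n)
    rw [Nat.add_sub_cancel] at this
    exact_mod_cast this
  have hn : (n.factorial : ℂ) ≠ 0 := by exact_mod_cast n.factorial_ne_zero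
  have hnk : ((n + k).factorial : ℂ) ≠ 0 := by exact_mod_cast (n + k).factorial_ne_zero
  have hit : iteratedDeriv n (iteratedDeriv k f) = iteratedDeriv (n + k) f := by
    rw [iteratedDeriv_eq_iterate, iteratedDeriv_eq_iterate, iteratedDeriv_eq_iterate,
      Function.iterate_add_apply]
  rw [taylorCoeff, hit, smul_eq_mul, smul_eq_mul, sub_zero, pow_add]
  have hd : (((n + k).descFactorial k : ℕ) : ℂ) = (n + k).factorial / n.factorial := by
    rw [← hfac]
    field_simp
  rw [hd]
  field_simp

theorem hasSum_taylorCoeff {f : ℂ → ℂ} (hf : DifferentiableOn ℂ f (Metric.ball 0 1)) {z : ℂ}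
    (hz : ‖z‖ < 1) : HasSum (fun n => taylorCoeff f n * z ^ n) (f z) := by
  simpa using hasSum_pow_mul_iteratedDeriv hf 0 hz

theorem hasSum_mul_deriv {f : ℂ → ℂ} (hf : DifferentiableOn ℂ f (Metric.ball 0 1)) {z : ℂ}
    (hz : ‖z‖ < 1) : HasSum (fun n => n * taylorCoeff f n * z ^ n) (z * deriv f z) := by
  simpa using hasSum_pow_mul_iteratedDeriv hf 1 hz

theorem hasSum_div_self {f : ℂ → ℂ} (hf : DifferentiableOn ℂ f (Metric.ball 0 1)) (hf0 : f 0 = 0)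
    {z : ℂ} (hz : ‖z‖ < 1) (hz0 : z ≠ 0) :
    HasSum (fun n => taylorCoeff (deriv f) n / (n + 1) * z ^ n) (f z / z) := by
  have h := hasSum_taylorCoeff hf hz
  rw [← hasSum_nat_add_iff' 1] at h
  have h0 : taylorCoeff f 0 = 0 := by simp [taylorCoeff, hf0]
  rw [Finset.sum_range_one, h0, zero_mul, sub_zero] at h
  refine hasSum_of_forall_eq (h.div_const z) fun n => ?_
  have hn : (n.factorial : ℂ) ≠ 0 := by exact_mod_cast n.factorial_ne_zero
  have hn1 : (n : ℂ) + 1 ≠ 0 := by exact_mod_cast n.succ_ne_zero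
  rw [taylorCoeff, taylorCoeff, iteratedDeriv_succ', Nat.factorial_succ, pow_succ]
  push_cast
  field_simp

/-- The symbol `1 + αn + γn(n-1)` factors because `α - γ = μ + ν` and `γ = μν`. -/
theorem hasSum_differential_operator {F : ℂ → ℂ} (hF : DifferentiableOn ℂ F (Metric.ball 0 1))
    {α γ μ ν : ℝ} (hadd : μ + ν = α - γ) (hmul : μ * ν = γ) {z : ℂ} (hz : ‖z‖ < 1) :
    HasSum (fun n : ℕ => (1 + μ * n) * (1 + ν * n) * taylorCoeff (deriv F) n * z ^ n)
      (deriv F z + (α : ℂ) * z * iteratedDeriv 2 F z + (γ : ℂ) * z ^ 2 * iteratedDeriv 3 F z) := by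
  have hd := hF.deriv Metric.isOpen_ball
  have h1 := hasSum_mul_deriv hd hz
  have h2 := hasSum_pow_mul_iteratedDeriv hd 2 hz
  have h := ((hasSum_taylorCoeff hd hz).add (h1.mul_left (α : ℂ))).add (h2.mul_left (γ : ℂ))
  rw [iteratedDeriv_succ' (n := 1), iteratedDeriv_succ' (n := 2), iteratedDeriv_one, mul_assoc,
    mul_assoc]
  refine hasSum_of_forall_eq h fun n => ?_
  have hα : (α : ℂ) = μ + ν + γ := by
    have : α = μ + ν + γ := by linarith
    rw [this]
    push_cast
    ring
  rw [Nat.cast_descFactorial_two, hα, ← hmul]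
  push_cast
  ring

section Representation

variable {m : Measure ℂ} {τ : Measure ℝ}

theorem ae_norm_le [SFinite m] [SFinite τ] (hm : ∀ᵐ ω ∂m, ‖ω‖ = 1)
    (hI : ∀ᵐ s ∂τ, s ∈ Set.Icc (0 : ℝ) 1) (x : ℂ) :
    ∀ᵐ p ∂m.prod τ, p.2 ∈ Set.Icc (0 : ℝ) 1 ∧ ‖x * p.1 * (p.2 : ℂ)‖ = ‖x‖ * p.2 := by
  filter_upwards [Measure.quasiMeasurePreserving_fst.ae hm,
    Measure.quasiMeasurePreserving_snd.ae hI] with p hp hs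
  refine ⟨hs, ?_⟩
  rw [norm_mul, norm_mul, hp, mul_one, Complex.norm_real, Real.norm_of_nonneg hs.1]

/-- Stated for a general `a` so that it covers both `1/(n+1)` and `1/(n+1)²` with the same
subtracted term. -/
theorem integrable_and_hasSum_prod [IsFiniteMeasure m] [IsProbabilityMeasure τ]
    (hm : ∀ᵐ ω ∂m, ‖ω‖ = 1) (hI : ∀ᵐ s ∂τ, s ∈ Set.Icc (0 : ℝ) 1) {β ρ : ℝ} {z : ℂ}
    (hzρ : ‖z‖ < ρ) (hmass : m.real Set.univ = 1 - β) {h : ℕ → ℂ} (h0 : h 0 = 1)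
    (hmom : ∀ n ≠ 0, h n * ρ ^ n = 2 * ∫ ω, ω ^ n ∂m) {c : ℕ → ℝ}
    (hc : ∀ n, ∫ s, s ^ n ∂τ = c n) (hβ : β = (1 - β) * (1 - 2 * ∫ s, recipValue s ∂τ))
    {a : ℕ → ℂ} (ha : ∀ n, ‖a n‖ ≤ 1) (ha0 : a 0 = 1) {U : ℂ → ℂ}
    (hU : ∀ w : ℂ, ‖w‖ < 1 → HasSum (fun n => a n * w ^ n) (U w)) :
    Integrable (fun p : ℂ × ℝ => U (z / ρ * p.1 * (p.2 : ℂ)) - recipValue p.2) (m.prod τ) ∧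
      HasSum (fun n => a n * (c n * h n) * z ^ n)
        (∫ p : ℂ × ℝ, 2 * (U (z / ρ * p.1 * (p.2 : ℂ)) - recipValue p.2) ∂m.prod τ) := by
  have hρ : 0 < ρ := (norm_nonneg z).trans_lt hzρ
  have hρc : (ρ : ℂ) ≠ 0 := by exact_mod_cast hρ.ne'
  have hx : ‖z / ρ‖ < 1 := by
    rwa [norm_div, Complex.norm_real, Real.norm_of_nonneg hρ.le, div_lt_one hρ]
  have hS : Summable fun n => ‖a n‖ * ‖z / ρ‖ ^ n :=
    Summable.of_nonneg_of_le (fun n => by positivity)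
      (fun n => mul_le_of_le_one_left (by positivity) (ha n))
      (summable_geometric_of_lt_one (norm_nonneg _) hx)
  obtain ⟨hint, hsum⟩ := integrable_and_hasSum_integral (μ := m.prod τ) (w := fun _ => 1)
    (ζ := fun p : ℂ × ℝ => z / ρ * p.1 * (p.2 : ℂ)) (integrable_const _)
    (Measurable.aestronglyMeasurable (by fun_prop)) (q := ‖z / ρ‖) (by
      filter_upwards [ae_norm_le hm hI (z / ρ)] with p hp
      rw [hp.2]
      exact mul_le_of_le_one_right (norm_nonneg _) hp.1.2) hS
    (fun w hw => hU w (hw.trans_lt hx))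
  simp only [one_mul] at hint hsum
  have hv : Integrable (fun p : ℂ × ℝ => (recipValue p.2 : ℂ)) (m.prod τ) := by
    have hr : Integrable (fun s => (recipValue s : ℂ)) τ := (integrable_recipValue hI).ofReal
    exact hr.comp_snd m
  refine ⟨hint.sub hv, ?_⟩
  have hvi : ∫ p : ℂ × ℝ, (recipValue p.2 : ℂ) ∂m.prod τ =
      (1 - β) * (∫ s, recipValue s ∂τ : ℝ) := by
    have := integral_fun_snd (μ := m) (ν := τ) fun s : ℝ => (recipValue s : ℂ)
    rw [this, hmass, integral_complex_ofReal, Complex.real_smul]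
    push_cast
    rfl
  have hβ' : (β : ℂ) = (1 - β) * (1 - 2 * (∫ s, recipValue s ∂τ : ℝ)) := by
    exact_mod_cast hβ
  rw [integral_const_mul, integral_sub hint hv, hvi]
  have hval : 2 * (∫ p : ℂ × ℝ, U (z / ρ * p.1 * (p.2 : ℂ)) ∂m.prod τ -
      (1 - β) * (∫ s, recipValue s ∂τ : ℝ)) =
      2 * (∫ p : ℂ × ℝ, U (z / ρ * p.1 * (p.2 : ℂ)) ∂m.prod τ) + (1 - 2 * (1 - β)) := by
    linear_combination -hβ'
  rw [hval]
  -- The moment relation fails only at `n = 0`, where `2 m(univ) = 2(1 - β)` must be corrected to `h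
  -- 0 = 1`; `hβ` makes this correction equal to the integral of `-2 recipValue`.
  refine hasSum_of_forall_eq ((hsum.mul_left 2).add
    (hasSum_ite_eq (0 : ℕ) (1 - 2 * (1 - (β : ℂ))))) fun n => ?_
  have hmn : ∫ p : ℂ × ℝ, (z / ρ * p.1 * (p.2 : ℂ)) ^ n ∂m.prod τ =
      (z / ρ) ^ n * ((∫ ω, ω ^ n ∂m) * c n) := by
    have := integral_prod_mul (μ := m) (ν := τ) (fun ω : ℂ => ω ^ n) fun s : ℝ => (s : ℂ) ^ n
    have hcn : ∫ s : ℝ, (s : ℂ) ^ n ∂τ = c n := by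
      rw [← hc, ← integral_complex_ofReal]
      simp
    rw [← hcn, ← this, ← integral_const_mul]
    congr 1
    ext p
    ring
  rw [hmn]
  split_ifs with hn
  · subst hn
    have hc0 : c 0 = 1 := by rw [← hc]; simp
    simp only [pow_zero, integral_const, hmass, hc0, ha0, h0, Complex.real_smul]
    push_cast
    ring
  · have := hmom n hn
    rw [div_pow]
    have hρn := pow_ne_zero n hρc
    field_simp
    linear_combination c n * a n * z ^ n * this

end Representation

end Pascu

/-! ### From the pointwise bound to a positive real part -/

namespace Pascu

open MeasureTheory

/-- `|x+y|² - |x-y|² = 4 Re(x ȳ)`, which has the sign of `Re(x/y)`; strictness also excludes `y =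
0`. -/
theorem div_re_pos_of_norm_sub_lt {x y : ℂ} (h : ‖x - y‖ < (x + y).re) : 0 < (x / y).re := by
  have h1 : ‖x - y‖ ^ 2 < ‖x + y‖ ^ 2 :=
    pow_lt_pow_left₀ (h.trans_le (Complex.re_le_norm _)) (norm_nonneg _) two_ne_zero
  rw [← Complex.normSq_eq_norm_sq, ← Complex.normSq_eq_norm_sq, Complex.normSq_sub,
    Complex.normSq_add] at h1
  have h2 : 0 < (x * starRingEnd ℂ y).re := by linarith
  have hy : y ≠ 0 := by
    rintro rfl
    simp at h2
  rw [Complex.div_re, ← add_div]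
  refine div_pos ?_ (Complex.normSq_pos.2 hy)
  simpa using h2

/-- The pointwise bound at `w = xωs` involves `recipValue (‖x‖ s)`, while the integrands subtract
`recipValue s`; the gap, at least `s(1 - ‖x‖)/8`, has positive integral. -/
theorem norm_integral_sub_lt {m : Measure ℂ} {τ : Measure ℝ} [IsFiniteMeasure m]
    [IsProbabilityMeasure τ] (hm : ∀ᵐ ω ∂m, ‖ω‖ = 1) (hI : ∀ᵐ s ∂τ, s ∈ Set.Icc (0 : ℝ) 1)
    (hmass : 0 < m.real Set.univ) (hτ : 0 < ∫ s, s ∂τ) {x : ℂ} (hx : ‖x‖ < 1)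
    (hU : Integrable (fun p : ℂ × ℝ => recipTransform (x * p.1 * (p.2 : ℂ)) - recipValue p.2)
      (m.prod τ))
    (hV : Integrable (fun p : ℂ × ℝ => sqRecipTransform (x * p.1 * (p.2 : ℂ)) - recipValue p.2)
      (m.prod τ)) :
    ‖(∫ p : ℂ × ℝ, 2 * (recipTransform (x * p.1 * (p.2 : ℂ)) - recipValue p.2) ∂m.prod τ) -
      ∫ p : ℂ × ℝ, 2 * (sqRecipTransform (x * p.1 * (p.2 : ℂ)) - recipValue p.2) ∂m.prod τ‖ <
    ((∫ p : ℂ × ℝ, 2 * (recipTransform (x * p.1 * (p.2 : ℂ)) - recipValue p.2) ∂m.prod τ) +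
      ∫ p : ℂ × ℝ, 2 * (sqRecipTransform (x * p.1 * (p.2 : ℂ)) - recipValue p.2) ∂m.prod τ).re := by
  have hs : Integrable (fun s : ℝ => s) τ := Integrable.of_bound (by fun_prop) 1 (by
    filter_upwards [hI] with s hs
    rw [Real.norm_of_nonneg hs.1]
    exact hs.2)
  have hsp : Integrable (fun p : ℂ × ℝ => p.2) (m.prod τ) := hs.comp_snd m
  have hsi : ∫ p : ℂ × ℝ, p.2 * ((1 - ‖x‖) / 2) ∂m.prod τ =
      m.real Set.univ * (∫ s, s ∂τ) * ((1 - ‖x‖) / 2) := by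
    rw [integral_mul_const, integral_fun_snd (μ := m) (ν := τ) fun s : ℝ => s, smul_eq_mul]
  have hpos : 0 < ∫ p : ℂ × ℝ, p.2 * ((1 - ‖x‖) / 2) ∂m.prod τ := by
    rw [hsi]
    have : 0 < 1 - ‖x‖ := by linarith
    positivity
  rw [← integral_sub (hU.const_mul 2) (hV.const_mul 2),
    ← integral_add (hU.const_mul 2) (hV.const_mul 2)]
  have hUV := (hU.const_mul 2).add (hV.const_mul 2)
  have hre := integral_re hUV
  simp only [RCLike.re_eq_complex_re, Pi.add_apply] at hre
  rw [← hre]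
  have hle := norm_integral_le_integral_norm (μ := m.prod τ) fun p : ℂ × ℝ =>
    2 * (recipTransform (x * p.1 * (p.2 : ℂ)) - recipValue p.2) -
      2 * (sqRecipTransform (x * p.1 * (p.2 : ℂ)) - recipValue p.2)
  -- The slack `s(1 - ‖x‖)/2` is four times the gap: two copies of `recipValue`, doubled by the
  -- factor `2`.
  have hmono := integral_mono_ae
    (((hU.const_mul 2).sub (hV.const_mul 2)).norm.add (hsp.mul_const ((1 - ‖x‖) / 2))) hUV.re (by
      filter_upwards [ae_norm_le hm hI x] with p hp
      have hlt : ‖x * p.1 * (p.2 : ℂ)‖ < 1 := by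
        rw [hp.2]
        nlinarith [norm_nonneg x, hp.1.2]
      have h1 := norm_recipTransform_sub_le hlt
      have h2 := recipValue_add_le hp.1 (q := ‖x‖) ⟨norm_nonneg x, hx.le⟩
      rw [hp.2] at h1
      simp only [Pi.add_apply, Pi.sub_apply, RCLike.re_eq_complex_re]
      rw [← mul_sub, ← mul_add, sub_sub_sub_cancel_right, norm_mul]
      simp only [Complex.norm_ofNat, Complex.add_re, Complex.sub_re, Complex.mul_re,
        Complex.ofReal_re, Complex.re_ofNat, Complex.im_ofNat, zero_mul, sub_zero] at h1 ⊢
      linarith)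
  simp only [Pi.add_apply, Pi.sub_apply, RCLike.re_eq_complex_re] at hmono
  have hnorm : Integrable (fun p : ℂ × ℝ =>
      ‖2 * (recipTransform (x * p.1 * (p.2 : ℂ)) - recipValue p.2) -
        2 * (sqRecipTransform (x * p.1 * (p.2 : ℂ)) - recipValue p.2)‖) (m.prod τ) :=
    ((hU.const_mul 2).sub (hV.const_mul 2)).norm
  rw [integral_add hnorm (hsp.mul_const ((1 - ‖x‖) / 2))] at hmono
  linarith

end Pascu

/-! ### Assembly of the proof -/

theorem mainTheorem5 (ξ α γ μ ν β : ℝ) (hξ0 : 0 ≤ ξ) (hξ1 : ξ ≤ 1)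
    (hμ : 1 ≤ μ) (hμν : μ ≤ ν) (hadd : μ + ν = α - γ) (hmul : μ * ν = γ)
    (hβ1 : β < 1) (hβ : Pascu.BetaCondition (fun _ => 1) ξ μ ν β)
    (F : ℂ → ℂ) (hF : Pascu.ClassA F)
    (hre : ∀ z : ℂ, ‖z‖ < 1 →
      β < (deriv F z + (α : ℂ) * z * iteratedDeriv 2 F z
        + (γ : ℂ) * z ^ 2 * iteratedDeriv 3 F z).re) :
    Pascu.ClassM ξ F := by
  refine ⟨hF, fun z hz hz0 => ?_⟩
  obtain ⟨hFd, hF0, hF1⟩ := hF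
  have hd := hFd.deriv Metric.isOpen_ball
  obtain ⟨τ, hτ, hI, hmom⟩ := Pascu.exists_measure_kernelCoeff hξ0 hξ1 hμ hμν
  have hβ' : β = (1 - β) * (1 - 2 * ∫ s, Pascu.recipValue s ∂τ) := by
    rw [Pascu.BetaCondition] at hβ
    simp only [one_mul] at hβ
    rw [Pascu.integral_weight hμ hμν hI hmom, div_eq_iff (by linarith)] at hβ
    linarith
  obtain ⟨ρ, hzρ, hρ1⟩ := exists_between hz
  have hρ : 0 < ρ := (norm_nonneg z).trans_lt hzρ
  have hH : ∀ w : ℂ, ‖w‖ < 1 → _ := fun w hw =>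
    Pascu.hasSum_differential_operator hFd hadd hmul hw
  have hcont : ContinuousOn (fun w => deriv F w + (α : ℂ) * w * iteratedDeriv 2 F w
      + (γ : ℂ) * w ^ 2 * iteratedDeriv 3 F w) (Metric.ball 0 1) :=
    (hd.continuousOn.add ((by fun_prop : Continuous fun w : ℂ => (α : ℂ) * w).continuousOn.mul
      (Pascu.differentiableOn_iteratedDeriv hFd 2).continuousOn)).add
      ((by fun_prop : Continuous fun w : ℂ => (γ : ℂ) * w ^ 2).continuousOn.mul
      (Pascu.differentiableOn_iteratedDeriv hFd 3).continuousOn)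
  have h0 : (1 + (μ : ℂ) * (0 : ℕ)) * (1 + ν * (0 : ℕ)) * Pascu.taylorCoeff (deriv F) 0 = 1 := by
    simp [Pascu.taylorCoeff, hF1]
  obtain ⟨m, hmf, hm, hmass, hmn⟩ := Pascu.exists_herglotz_measure hH hcont hρ.le hρ1 h0 hre
  have hnat : ∀ n : ℕ, 1 ≤ ‖(n : ℂ) + 1‖ := fun n => by
    rw [← Nat.cast_succ, Complex.norm_natCast]
    exact_mod_cast n.succ_pos
  obtain ⟨hUi, hUs⟩ := Pascu.integrable_and_hasSum_prod hm hI hzρ hmass h0 hmn hmom hβ'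
    (fun n => by
      rw [norm_div, norm_one]
      exact div_le_one_of_le₀ (hnat n) (norm_nonneg _)) (by simp)
    (fun w hw => Pascu.hasSum_recipTransform hw)
  obtain ⟨hVi, hVs⟩ := Pascu.integrable_and_hasSum_prod hm hI hzρ hmass h0 hmn hmom hβ'
    (fun n => by
      rw [norm_div, norm_one, norm_pow]
      exact div_le_one_of_le₀ (one_le_pow₀ (hnat n)) (by positivity)) (by simp)
    (fun w hw => Pascu.hasSum_sqRecipTransform hw)
  have hcoef : ∀ n : ℕ, (Pascu.kernelCoeff ξ μ ν n : ℂ) *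
      ((1 + (μ : ℂ) * n) * (1 + ν * n) * Pascu.taylorCoeff (deriv F) n) =
      (1 + ξ * n) * (n + 1) * Pascu.taylorCoeff (deriv F) n := fun n => by
    have hν := hμ.trans hμν
    have h1 : (1 + (μ : ℂ) * n) ≠ 0 := by
      have : (1 + μ * n : ℝ) ≠ 0 := by positivity
      exact_mod_cast this
    have h2 : (1 + (ν : ℂ) * n) ≠ 0 := by
      have : (1 + ν * n : ℝ) ≠ 0 := by positivity
      exact_mod_cast this
    rw [Pascu.kernelCoeff]
    push_cast
    rw [div_mul_eq_mul_div, div_eq_iff (mul_ne_zero h1 h2)]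
    ring
  -- The numerator over `z`, with coefficients `(1 + ξn) bₙ`.
  have hX := ((Pascu.hasSum_taylorCoeff hd hz).add
    ((Pascu.hasSum_mul_deriv hd hz).mul_left (ξ : ℂ))).unique
    (Pascu.hasSum_of_forall_eq hUs fun n => by
      have hn : (n : ℂ) + 1 ≠ 0 := by exact_mod_cast n.succ_ne_zero
      rw [hcoef]
      field_simp)
  -- The denominator over `z`: `ξ + (1 - ξ)/(n+1) = (1 + ξn)/(n+1)`, one more division by `n + 1`
  -- than the numerator.
  have hY := (((Pascu.hasSum_taylorCoeff hd hz).mul_left (ξ : ℂ)).add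
    ((Pascu.hasSum_div_self hFd hF0 hz hz0).mul_left (1 - (ξ : ℂ)))).unique
    (Pascu.hasSum_of_forall_eq hVs fun n => by
      have hn : (n : ℂ) + 1 ≠ 0 := by exact_mod_cast n.succ_ne_zero
      rw [hcoef]
      field_simp
      ring)
  have hx : ‖z / ρ‖ < 1 := by
    rwa [norm_div, Complex.norm_real, Real.norm_of_nonneg hρ.le, div_lt_one hρ]
  have hτ1 : 0 < ∫ s, s ∂τ := by
    have h := hmom 1
    simp only [pow_one] at h
    have hν := hμ.trans hμν
    rw [h, Pascu.kernelCoeff]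
    positivity
  have key := Pascu.norm_integral_sub_lt hm hI (by rw [hmass]; linarith) hτ1 hx hUi hVi
  rw [← hX, ← hY] at key
  have hpos := Pascu.div_re_pos_of_norm_sub_lt key
  have hderiv : deriv (fun w : ℂ => w * deriv F w) z = deriv F z + z * deriv (deriv F) z := by
    have := (hasDerivAt_id z).mul
      (hd.differentiableAt (Metric.isOpen_ball.mem_nhds (mem_ball_zero_iff.2 hz))).hasDerivAt
    exact this.deriv.trans (by simp)
  have hquot : ((ξ : ℂ) * z * deriv (fun w : ℂ => w * deriv F w) z +
      (1 - (ξ : ℂ)) * z * deriv F z) / ((ξ : ℂ) * z * deriv F z + (1 - (ξ : ℂ)) * F z) =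
      (deriv F z + ξ * (z * deriv (deriv F) z)) / (ξ * deriv F z + (1 - ξ) * (F z / z)) := by
    rw [hderiv, ← mul_div_mul_left _ (ξ * deriv F z + (1 - ξ) * (F z / z)) hz0]
    congr 1
    · ring
    · field_simp
  rwa [hquot]
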